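/- Let $A_1,A_2$ be unital complex $C^*$-algebras, each equipped with a $\mathbb{Z}_2$-grading, i.e. a $*$-automorphism $\theta_i$ of $A_i$ with $\theta_i^2=\mathrm{id}$. An element $a\in A_i$ is homogeneous of grade $\partial a=\pm1$ if $\theta_i(a)=\pm a$. The Fermi tensor product $A_1\,Ⓕ\,A_2$ is the algebraic tensor product $A_1\odot A_2$ with the product and involution determined, on homogeneous elements, by $$(a_1\otimes a_2)(b_1\otimes b_2)=\epsilon(a_2,b_1)\,a_1b_1\otimes a_2b_2,\qquad (a_1\otimes a_2)^*=\epsilon(a_1,a_2)\,a_1^*\otimes a_2^*,$$ where $\epsilon(a,b)=-1$ if $\partial a=\partial b=-1$ and $\epsilon(a,b)=1$ otherwise. Its grading is $\theta=\theta_1\otimes\theta_2$. A state $\omega$ of $A_i$ is even if $\omega\circ\theta_i=\omega$. For even states $\omega_1,\omega_2$ of $A_1,A_2$, let $\pi_{\omega_1\times\omega_2}$ be the GNS representation of $A_1\,Ⓕ\,A_2$ given by the product state $(\omega_1\times\omega_2)(a_1\otimes a_2)=\omega_1(a_1)\omega_2(a_2)$. The spatial norm is $$\|x\|_{\min}=\sup\{\|\pi_{\omega_1\times\omega_2}(x)\|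 : \omega_i \text{ an even state of } A_i,\ i=1,2\},\qquad x\in A_1\,Ⓕ\,A_2 .$$ A $C^*$-norm $\beta$ on $A_1\,Ⓕ\,A_2$ is called cross if $\beta(a_1\otimes a_2)=\|a_1\|\,\|a_2\|$ for all homogeneous $a_1\in A_1$, $a_2\in A_2$, and compatible if $\theta$ extends to a $*$-automorphism of the completion of $A_1\,Ⓕ\,A_2$ with respect to $\beta$. If $A_1$ or $A_2$ is commutative, then every compatible $C^*$-cross norm $\beta$ on $A_1\,Ⓕ\,A_2$ coincides with the spatial norm: $\beta(x)=\|x\|_{\min}$ for every $x\in A_1\,Ⓕ\,A_2$. -/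

import Mathlib

open scoped TensorProduct ComplexOrder InnerProductSpace
open UniformSpace

noncomputable section

/-! ### Positive functionals on unital complex `*`-algebras and the GNS construction -/

section GNS

/-- A positive linear functional on a unital complex `*`-algebra. -/
structure PositiveFunctional (F : Type*) [Ring F] [StarRing F] [Algebra ℂ F] extends
    F →ₗ[ℂ] ℂ where
  nonneg' : ∀ x : F, 0 ≤ toFun (star x * x)

namespace PositiveFunctional

variable {F : Type*} [Ring F] [StarRing F] [Algebra ℂ F]

theorem nonneg (φ : PositiveFunctional F) (x : F) : 0 ≤ φ.toLinearMap (star x * x) :=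
  φ.nonneg' x

variable [StarModule ℂ F]

theorem apply_star (φ : PositiveFunctional F) (x : F) :
    φ.toLinearMap (star x) = star (φ.toLinearMap x) := by
  have h1 := (Complex.nonneg_iff.1 (φ.nonneg (x + 1))).2
  have h2 := (Complex.nonneg_iff.1 (φ.nonneg (x + Complex.I • 1))).2
  have h3 := (Complex.nonneg_iff.1 (φ.nonneg x)).2
  have h4 := (Complex.nonneg_iff.1 (φ.nonneg 1)).2
  simp only [star_add, star_smul, star_one, add_mul, mul_add, mul_one, one_mul, smul_mul_assoc,
    mul_smul_comm, map_add, map_smul, smul_eq_mul, Complex.add_im, Complex.mul_im, Complex.mul_re,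
    Complex.star_def, Complex.conj_I, Complex.neg_im, Complex.neg_re, Complex.I_re,
    Complex.I_im] at h1 h2 h3 h4
  apply Complex.ext <;> simp only [Complex.star_def, Complex.conj_re, Complex.conj_im] <;> linarith

/-- The algebra `F`, regarded as a space with the semi-inner product `⟪x, y⟫ = φ (x* y)`. -/
def PreGNS (_φ : PositiveFunctional F) := F

variable (φ : PositiveFunctional F)

instance : AddCommGroup φ.PreGNS := inferInstanceAs (AddCommGroup F)
instance : Module ℂ φ.PreGNS := inferInstanceAs (Module ℂ F)

/-- The identity map from the algebra to the pre-GNS space. -/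
def toPre : F ≃ₗ[ℂ] φ.PreGNS := LinearEquiv.refl ℂ _

abbrev preCore : PreInnerProductSpace.Core ℂ φ.PreGNS where
  inner x y := φ.toLinearMap (star (φ.toPre.symm x) * φ.toPre.symm y)
  conj_inner_symm x y := by
    rw [← Complex.star_def, ← φ.apply_star, star_mul, star_star]
  re_inner_nonneg x := (Complex.nonneg_iff.1 (φ.nonneg (φ.toPre.symm x))).1
  add_left x y z := by rw [map_add, star_add, add_mul, map_add]
  smul_left x y c := by simp

instance : SeminormedAddCommGroup φ.PreGNS :=
  InnerProductSpace.Core.toSeminormedAddCommGroup (c := φ.preCore)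
instance : InnerProductSpace ℂ φ.PreGNS := InnerProductSpace.ofCore φ.preCore

theorem inner_toPre (x y : F) :
    ⟪φ.toPre x, φ.toPre y⟫_ℂ = φ.toLinearMap (star x * y) := rfl

theorem norm_toPre_sq (x : F) : ‖φ.toPre x‖ ^ 2 = (φ.toLinearMap (star x * x)).re := by
  rw [← inner_toPre, ← inner_self_eq_norm_sq (𝕜 := ℂ)]; rfl

/-- The GNS Hilbert space: the Hausdorff completion of `F` for `⟪x, y⟫ = φ (x* y)`. -/
abbrev GNS := Completion φ.PreGNS

/-- Left multiplication by `x` is bounded on the pre-GNS space. -/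
def LeftBounded (x : F) : Prop := ∃ C : ℝ, ∀ y : F, ‖φ.toPre (x * y)‖ ≤ C * ‖φ.toPre y‖

variable {φ}

theorem LeftBounded.add {x y : F} (hx : φ.LeftBounded x) (hy : φ.LeftBounded y) :
    φ.LeftBounded (x + y) := by
  obtain ⟨C, hC⟩ := hx
  obtain ⟨D, hD⟩ := hy
  refine ⟨C + D, fun z => ?_⟩
  rw [add_mul, map_add, add_mul]
  exact (norm_add_le _ _).trans (add_le_add (hC z) (hD z))

theorem LeftBounded.mul {x y : F} (hx : φ.LeftBounded x) (hy : φ.LeftBounded y) :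
    φ.LeftBounded (x * y) := by
  obtain ⟨C, hC⟩ := hx
  obtain ⟨D, hD⟩ := hy
  refine ⟨|C| * D, fun z => ?_⟩
  rw [mul_assoc, mul_assoc]
  refine (hC _).trans ((mul_le_mul_of_nonneg_right (le_abs_self C) (norm_nonneg _)).trans ?_)
  exact mul_le_mul_of_nonneg_left (hD z) (abs_nonneg C)

theorem leftBounded_of_starAlgHom {A : Type*} [CStarAlgebra A] (j : A →⋆ₐ[ℂ] F) (a : A) :
    φ.LeftBounded (j a) := by
  let _ := CStarAlgebra.spectralOrder A
  let _ := CStarAlgebra.spectralOrderedRing A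
  have h : star a * a ≤ algebraMap ℝ A ‖star a * a‖ :=
    IsSelfAdjoint.le_algebraMap_norm_self (IsSelfAdjoint.star_mul_self a)
  obtain ⟨c, hc⟩ := CStarAlgebra.nonneg_iff_eq_star_mul_self.1 (sub_nonneg.2 h)
  refine ⟨‖a‖, fun y => ?_⟩
  rw [← abs_of_nonneg (norm_nonneg a), ← abs_of_nonneg (norm_nonneg (φ.toPre y)), ← abs_mul,
    ← abs_of_nonneg (norm_nonneg (φ.toPre (j a * y))), ← sq_le_sq, mul_pow, norm_toPre_sq,
    norm_toPre_sq]
  have h1 := (Complex.nonneg_iff.1 (φ.nonneg (j c * y))).1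
  have h2 : star (j c * y) * (j c * y) =
      ((‖a‖ ^ 2 : ℝ) : ℂ) • (star y * y) - star (j a * y) * (j a * y) := by
    have h3 : j (star c * c) = ((‖a‖ ^ 2 : ℝ) : ℂ) • 1 - j (star a * a) := by
      rw [← hc, map_sub, CStarRing.norm_star_mul_self, ← sq,
        IsScalarTower.algebraMap_apply ℝ ℂ A, AlgHomClass.commutes j,
        Algebra.algebraMap_eq_smul_one]
      rfl
    rw [map_mul, map_mul, map_star, map_star] at h3
    calc star (j c * y) * (j c * y) = star y * (star (j c) * j c) * y := by
          rw [star_mul]; noncomm_ring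
      _ = _ := by
          rw [h3, star_mul, mul_sub, sub_mul, mul_smul_comm, mul_one, smul_mul_assoc]
          noncomm_ring
  rw [h2, map_sub, map_smul, smul_eq_mul, Complex.sub_re, Complex.re_ofReal_mul] at h1
  linarith

variable (φ)

/-- Left multiplication as a bounded operator on the pre-GNS space. -/
def leftMul (hφ : ∀ x, φ.LeftBounded x) (x : F) : φ.PreGNS →L[ℂ] φ.PreGNS :=
  (φ.toPre.toLinearMap ∘ₗ LinearMap.mulLeft ℂ x ∘ₗ
    φ.toPre.symm.toLinearMap).mkContinuousOfExistsBound (hφ x)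

@[simp]
theorem leftMul_toPre (hφ : ∀ x, φ.LeftBounded x) (x y : F) :
    φ.leftMul hφ x (φ.toPre y) = φ.toPre (x * y) := rfl

theorem gns_ext {S T : φ.GNS →L[ℂ] φ.GNS}
    (h : ∀ y : F, S (φ.toPre y : φ.GNS) = T (φ.toPre y : φ.GNS)) : S = T := by
  ext z
  induction z using Completion.induction_on with
  | hp => exact isClosed_eq S.continuous T.continuous
  | ih z => exact h z

/-- The GNS representation: `π(x)` is the extension to the GNS space of `y ↦ x y`. -/
def gnsRep (hφ : ∀ x, φ.LeftBounded x) : F →⋆ₐ[ℂ] (φ.GNS →L[ℂ] φ.GNS) where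
  toFun x := (φ.leftMul hφ x).completion
  map_one' := φ.gns_ext fun y => by simp
  map_mul' a b := φ.gns_ext fun y => by simp [mul_assoc]
  map_zero' := φ.gns_ext fun y => by
    simp only [ContinuousLinearMap.completion_apply_coe, leftMul_toPre, zero_mul, map_zero]
    exact Completion.coe_zero
  map_add' a b := φ.gns_ext fun y => by simp [add_mul, Completion.coe_add]
  commutes' r := φ.gns_ext fun y => by
    simp [Algebra.algebraMap_eq_smul_one]
  map_star' a := by
    refine (ContinuousLinearMap.eq_adjoint_iff _ _).mpr fun x y => ?_
    induction x, y using Completion.induction_on₂ with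
    | hp => apply isClosed_eq <;> fun_prop
    | ih x y =>
      obtain ⟨x, rfl⟩ := φ.toPre.surjective x
      obtain ⟨y, rfl⟩ := φ.toPre.surjective y
      simp [inner_toPre, mul_assoc]

end PositiveFunctional

end GNS

/-! ### `C*`-norms on a `*`-algebra and their completions -/

section CStarNorm

/-- A `C*`-norm on a unital complex `*`-algebra. -/
structure CStarNorm (F : Type*) [Ring F] [StarRing F] [Algebra ℂ F] extends Seminorm ℂ F where
  eq_zero' : ∀ x, toFun x = 0 → x = 0
  mul_le' : ∀ x y, toFun (x * y) ≤ toFun x * toFun y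
  star_mul_self' : ∀ x, toFun (star x * x) = toFun x * toFun x

namespace CStarNorm

variable {F : Type*} [Ring F] [StarRing F] [Algebra ℂ F]

instance : CoeFun (CStarNorm F) (fun _ => F → ℝ) := ⟨fun β => β.toSeminorm⟩

theorem mul_le (β : CStarNorm F) (x y : F) : β (x * y) ≤ β x * β y := β.mul_le' x y
theorem star_mul_self (β : CStarNorm F) (x : F) : β (star x * x) = β x * β x :=
  β.star_mul_self' x

variable [StarModule ℂ F]

/-- The `*`-algebra `F` equipped with the norm `β`. -/
def Carrier (_β : CStarNorm F) := F

variable (β : CStarNorm F)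

instance : Ring β.Carrier := inferInstanceAs (Ring F)
instance : StarRing β.Carrier := inferInstanceAs (StarRing F)
instance : Algebra ℂ β.Carrier := inferInstanceAs (Algebra ℂ F)
instance : StarModule ℂ β.Carrier := inferInstanceAs (StarModule ℂ F)

/-- The identity map from `F` to `F` normed by `β`. -/
def toCarrier : F ≃⋆ₐ[ℂ] β.Carrier := StarAlgEquiv.refl ℂ F

instance : NormedRing β.Carrier :=
  { (inferInstance : Ring β.Carrier),
    (AddGroupNorm.toNormedAddCommGroup
      { toFun := β.toSeminorm
        map_zero' := map_zero β.toSeminorm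
        add_le' := map_add_le_add β.toSeminorm
        neg' := map_neg_eq_map β.toSeminorm
        eq_zero_of_map_eq_zero' := β.eq_zero' } : NormedAddCommGroup β.Carrier) with
    norm_mul_le := β.mul_le }

theorem norm_toCarrier (x : F) : ‖β.toCarrier x‖ = β x := rfl

instance : NormedAlgebra ℂ β.Carrier where
  norm_smul_le r x := (map_smul_eq_mul β.toSeminorm r x).le

instance : CStarRing β.Carrier where
  norm_mul_self_le x := (β.star_mul_self x).ge

/-- The completion of `F` with respect to the norm `β`. -/
abbrev Completion := UniformSpace.Completion β.Carrier

/-- The canonical map of `F` into its completion. -/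
def toCompletion (x : F) : β.Completion := (β.toCarrier x : UniformSpace.Completion β.Carrier)

/-- The involution of the completion is the continuous extension of the involution of `F`. -/
instance : Star β.Completion := ⟨UniformSpace.Completion.map star⟩

theorem continuous_star_completion : Continuous (star : β.Completion → β.Completion) :=
  UniformSpace.Completion.continuous_map

theorem coe_star (x : β.Carrier) : ((star x : β.Carrier) : β.Completion) = star (x : β.Completion) :=
  (UniformSpace.Completion.map_coe (starₗᵢ ℂ (E := β.Carrier)).isometry.uniformContinuous x).symm

theorem star_smul_completion (c : ℂ) (x : β.Completion) : star (c • x) = star c • star x := by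
  induction x using UniformSpace.Completion.induction_on with
  | hp =>
    exact isClosed_eq (β.continuous_star_completion.comp (continuous_const_smul c))
      (β.continuous_star_completion.const_smul (star c))
  | ih x =>
    rw [← UniformSpace.Completion.coe_smul, ← coe_star, ← coe_star,
      ← UniformSpace.Completion.coe_smul, star_smul]

instance : ContinuousStar β.Completion := ⟨β.continuous_star_completion⟩

/-- The completion is a `C*`-algebra. -/
instance : CStarAlgebra β.Completion :=
  { (inferInstance : NormedRing β.Completion),
    (inferInstance : Algebra ℂ β.Completion),
    (inferInstance : NormedSpace ℂ β.Completion) with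
    star_involutive := fun x => by
      induction x using UniformSpace.Completion.induction_on with
      | hp => exact isClosed_eq (by fun_prop) (by fun_prop)
      | ih x => rw [← coe_star, ← coe_star, star_star]
    star_mul := fun x y => by
      induction x, y using UniformSpace.Completion.induction_on₂ with
      | hp => exact isClosed_eq (by fun_prop) (by fun_prop)
      | ih x y =>
        rw [← UniformSpace.Completion.coe_mul, ← coe_star, ← coe_star, ← coe_star,
          ← UniformSpace.Completion.coe_mul, star_mul]
    star_add := fun x y => by
      induction x, y using UniformSpace.Completion.induction_on₂ with
      | hp => exact isClosed_eq (by fun_prop) (by fun_prop)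
      | ih x y =>
        rw [← UniformSpace.Completion.coe_add, ← coe_star, ← coe_star, ← coe_star,
          ← UniformSpace.Completion.coe_add, star_add]
    complete := CompleteSpace.complete
    norm_mul_self_le := fun x => by
      induction x using UniformSpace.Completion.induction_on with
      | hp => exact isClosed_le (by fun_prop) (by fun_prop)
      | ih x =>
        rw [← coe_star, ← UniformSpace.Completion.coe_mul, UniformSpace.Completion.norm_coe,
          UniformSpace.Completion.norm_coe]
        exact CStarRing.norm_mul_self_le x
    star_smul := β.star_smul_completion }

end CStarNorm

end CStarNorm

/-! ### `ℤ₂`-graded `C*`-algebras and their Fermi tensor product -/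

/-- A `ℤ₂`-grading of a `C*`-algebra: an involutive `*`-automorphism. -/
structure Grading (A : Type*) [CStarAlgebra A] where
  auto : A ≃⋆ₐ[ℂ] A
  involutive : ∀ a, auto (auto a) = a

namespace Grading

variable {A : Type*} [CStarAlgebra A] (θ : Grading A)

/-- The grading automorphism as a linear map. -/
def lin : A →ₗ[ℂ] A := (θ.auto : A ≃⋆ₐ[ℂ] A).toAlgEquiv.toLinearMap

@[simp] theorem lin_apply (a : A) : θ.lin a = θ.auto a := rfl

/-- The projection `(id + i θ) / 2` onto the homogeneous component of grade `i ∈ {1, -1}`. -/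
def proj (i : ℤˣ) : A →ₗ[ℂ] A := (2⁻¹ : ℂ) • (LinearMap.id + ((i : ℤ) : ℂ) • θ.lin)

/-- `a` is homogeneous: even (`θ a = a`) or odd (`θ a = -a`). -/
def IsHomogeneous (a : A) : Prop := θ.auto a = a ∨ θ.auto a = -a

theorem proj_apply (i : ℤˣ) (a : A) :
    θ.proj i a = (2⁻¹ : ℂ) • (a + ((i : ℤ) : ℂ) • θ.auto a) := rfl

theorem auto_smul (c : ℂ) (a : A) : θ.auto (c • a) = c • θ.auto a := map_smul θ.auto c a

theorem proj_add_proj (a : A) : θ.proj 1 a + θ.proj (-1) a = a := by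
  simp only [proj_apply, Units.val_one, Units.val_neg, Int.cast_one, Int.cast_neg]
  module

theorem proj_sub_proj (a : A) : θ.proj 1 a - θ.proj (-1) a = θ.auto a := by
  simp only [proj_apply, Units.val_one, Units.val_neg, Int.cast_one, Int.cast_neg]
  module

theorem auto_proj_one (a : A) : θ.auto (θ.proj 1 a) = θ.proj 1 a := by
  simp only [proj_apply, Units.val_one, Int.cast_one, auto_smul, map_add, θ.involutive]
  module

theorem auto_proj_neg_one (a : A) : θ.auto (θ.proj (-1) a) = -θ.proj (-1) a := by
  simp only [proj_apply, Units.val_one, Units.val_neg, Int.cast_one, Int.cast_neg, auto_smul,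
    map_add, θ.involutive]
  module

theorem proj_of_even {a : A} (h : θ.auto a = a) : θ.proj 1 a = a ∧ θ.proj (-1) a = 0 := by
  simp only [proj_apply, Units.val_one, Units.val_neg, Int.cast_one, Int.cast_neg, h]
  constructor <;> module

theorem proj_of_odd {a : A} (h : θ.auto a = -a) : θ.proj 1 a = 0 ∧ θ.proj (-1) a = a := by
  simp only [proj_apply, Units.val_one, Units.val_neg, Int.cast_one, Int.cast_neg, h]
  constructor <;> module

theorem proj_one_mul (i : ℤˣ) (a b : A) : θ.proj i (θ.proj 1 a * b) = θ.proj 1 a * θ.proj i b := by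
  rw [θ.proj_apply i, map_mul, auto_proj_one, θ.proj_apply i, mul_smul_comm, mul_add,
    mul_smul_comm]

theorem proj_neg_one_mul (i : ℤˣ) (a b : A) :
    θ.proj i (θ.proj (-1) a * b) = θ.proj (-1) a * θ.proj (-i) b := by
  rw [θ.proj_apply i, map_mul, auto_proj_neg_one, θ.proj_apply (-i), mul_smul_comm, mul_add,
    mul_smul_comm, Units.val_neg, Int.cast_neg, neg_mul, smul_neg, neg_smul]

theorem proj_star (i : ℤˣ) (a : A) : θ.proj i (star a) = star (θ.proj i a) := by
  rw [proj_apply, proj_apply, star_smul, star_add, star_smul, map_star]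
  simp

end Grading

/-- The sign `ε(i, j)`: it is `-1` if `i = j = -1` and `1` otherwise. -/
def fermiSign (i j : ℤˣ) : ℂ := if i = -1 ∧ j = -1 then -1 else 1

section Fermi

variable {A₁ A₂ : Type*} [CStarAlgebra A₁] [CStarAlgebra A₂]

/-- The component `x_{i,j}` of `x` in the tensor product of the homogeneous parts of grades `i`
and `j`. -/
def fermiComp (θ₁ : Grading A₁) (θ₂ : Grading A₂) (i j : ℤˣ) : A₁ ⊗[ℂ] A₂ →ₗ[ℂ] A₁ ⊗[ℂ] A₂ :=
  TensorProduct.map (θ₁.proj i) (θ₂.proj j)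

/-- The Fermi product `x y = ∑ ε(j, k) x_{i,j} y_{k,l}`, in terms of the usual product of the
algebraic tensor product. -/
def fermiMul (θ₁ : Grading A₁) (θ₂ : Grading A₂) :
    A₁ ⊗[ℂ] A₂ →ₗ[ℂ] A₁ ⊗[ℂ] A₂ →ₗ[ℂ] A₁ ⊗[ℂ] A₂ :=
  ∑ i : ℤˣ, ∑ j : ℤˣ, ∑ k : ℤˣ, ∑ l : ℤˣ, fermiSign j k •
    (LinearMap.mul ℂ (A₁ ⊗[ℂ] A₂)).compl₁₂ (fermiComp θ₁ θ₂ i j) (fermiComp θ₁ θ₂ k l)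

/-- The Fermi involution `x* = ∑ ε(i, j) x_{i,j}*`, in terms of the usual involution of the
algebraic tensor product. -/
def fermiStar (θ₁ : Grading A₁) (θ₂ : Grading A₂) (x : A₁ ⊗[ℂ] A₂) : A₁ ⊗[ℂ] A₂ :=
  ∑ i : ℤˣ, ∑ j : ℤˣ, fermiSign i j • star (fermiComp θ₁ θ₂ i j x)

theorem fermiMul_tmul (θ₁ : Grading A₁) (θ₂ : Grading A₂) (a c : A₁) (b d : A₂) :
    fermiMul θ₁ θ₂ (a ⊗ₜ b) (c ⊗ₜ d) =
      (a * c) ⊗ₜ (θ₂.proj 1 b * d) + (a * θ₁.auto c) ⊗ₜ (θ₂.proj (-1) b * d) := by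
  have h : (1 : ℤˣ) ≠ -1 := by decide
  conv_rhs => rw [← θ₁.proj_sub_proj c, ← θ₁.proj_add_proj a, ← θ₂.proj_add_proj d]
  conv_rhs => enter [1]; rw [← θ₁.proj_add_proj c]
  simp only [fermiMul, fermiSign, fermiComp, UnitsInt.univ, Finset.sum_pair h,
    LinearMap.add_apply, LinearMap.smul_apply, LinearMap.compl₁₂_apply, TensorProduct.map_tmul,
    LinearMap.mul_apply', Algebra.TensorProduct.tmul_mul_tmul, h, and_true,
    and_false, if_true, if_false, mul_add, add_mul, mul_sub, TensorProduct.add_tmul,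
    TensorProduct.tmul_add, TensorProduct.sub_tmul]
  module

theorem fermiStar_tmul (θ₁ : Grading A₁) (θ₂ : Grading A₂) (a : A₁) (b : A₂) :
    fermiStar θ₁ θ₂ (a ⊗ₜ b) =
      star a ⊗ₜ star (θ₂.proj 1 b) + star (θ₁.auto a) ⊗ₜ star (θ₂.proj (-1) b) := by
  have h : (1 : ℤˣ) ≠ -1 := by decide
  conv_rhs => rw [← θ₁.proj_sub_proj a]
  conv_rhs => enter [1]; rw [← θ₁.proj_add_proj a]
  simp only [fermiStar, fermiSign, fermiComp, UnitsInt.univ, Finset.sum_pair h,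
    TensorProduct.map_tmul, TensorProduct.star_tmul, h, and_true,
    and_false, if_true, if_false, star_add, star_sub, TensorProduct.add_tmul,
    TensorProduct.sub_tmul]
  module

theorem fermiStar_add (θ₁ : Grading A₁) (θ₂ : Grading A₂) (x y : A₁ ⊗[ℂ] A₂) :
    fermiStar θ₁ θ₂ (x + y) = fermiStar θ₁ θ₂ x + fermiStar θ₁ θ₂ y := by
  simp [fermiStar, Finset.sum_add_distrib]

theorem fermiMul_assoc (θ₁ : Grading A₁) (θ₂ : Grading A₂) (x y z : A₁ ⊗[ℂ] A₂) :
    fermiMul θ₁ θ₂ (fermiMul θ₁ θ₂ x y) z = fermiMul θ₁ θ₂ x (fermiMul θ₁ θ₂ y z) := by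
  induction x using TensorProduct.induction_on with
  | zero => simp
  | add x₁ x₂ h₁ h₂ => simp only [map_add, LinearMap.add_apply, h₁, h₂]
  | tmul a b =>
    induction y using TensorProduct.induction_on with
    | zero => simp
    | add x₁ x₂ h₁ h₂ => simp only [map_add, LinearMap.add_apply, h₁, h₂]
    | tmul c d =>
      induction z using TensorProduct.induction_on with
      | zero => simp
      | add x₁ x₂ h₁ h₂ => simp only [map_add, h₁, h₂]
      | tmul e f =>
        simp only [fermiMul_tmul, map_add, LinearMap.add_apply, Grading.proj_one_mul,
          Grading.proj_neg_one_mul, map_mul, θ₁.involutive, neg_neg, mul_assoc]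
        abel

theorem fermiStar_star (θ₁ : Grading A₁) (θ₂ : Grading A₂) (x : A₁ ⊗[ℂ] A₂) :
    fermiStar θ₁ θ₂ (fermiStar θ₁ θ₂ x) = x := by
  induction x using TensorProduct.induction_on with
  | zero => simp [fermiStar]
  | add x₁ x₂ h₁ h₂ => simp only [fermiStar_add, h₁, h₂]
  | tmul a b =>
    have e := θ₂.proj_of_even (θ₂.auto_proj_one b)
    have o := θ₂.proj_of_odd (θ₂.auto_proj_neg_one b)
    simp only [fermiStar_tmul, fermiStar_add, Grading.proj_star, e.1, e.2, o.1, o.2, star_star,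
      star_zero, TensorProduct.tmul_zero, map_star, θ₁.involutive, add_zero, zero_add]
    rw [← TensorProduct.tmul_add, θ₂.proj_add_proj]

theorem fermiStar_mul (θ₁ : Grading A₁) (θ₂ : Grading A₂) (x y : A₁ ⊗[ℂ] A₂) :
    fermiStar θ₁ θ₂ (fermiMul θ₁ θ₂ x y) =
      fermiMul θ₁ θ₂ (fermiStar θ₁ θ₂ y) (fermiStar θ₁ θ₂ x) := by
  induction x using TensorProduct.induction_on with
  | zero => simp [fermiStar]
  | add x₁ x₂ h₁ h₂ => simp only [map_add, LinearMap.add_apply, fermiStar_add, h₁, h₂]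
  | tmul a b =>
    induction y using TensorProduct.induction_on with
    | zero => simp [fermiStar]
    | add x₁ x₂ h₁ h₂ => simp only [map_add, LinearMap.add_apply, fermiStar_add, h₁, h₂]
    | tmul c d =>
      have e := θ₂.proj_of_even (θ₂.auto_proj_one d)
      have o := θ₂.proj_of_odd (θ₂.auto_proj_neg_one d)
      simp only [fermiMul_tmul, fermiStar_tmul, fermiStar_add, map_add, LinearMap.add_apply,
        Grading.proj_one_mul, Grading.proj_neg_one_mul, Grading.proj_star, e.1, e.2, o.1, o.2,
        star_mul, map_mul, map_star, star_zero, zero_mul, TensorProduct.tmul_zero,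
        θ₁.involutive, neg_neg, add_zero, zero_add]
      abel

/-- The algebraic Fermi tensor product `A₁ Ⓕ A₂`: as a linear space it is `A₁ ⊗ A₂`, with the
product `fermiMul` and the involution `fermiStar`. -/
def FermiTensor (_θ₁ : Grading A₁) (_θ₂ : Grading A₂) := A₁ ⊗[ℂ] A₂

namespace FermiTensor

variable {θ₁ : Grading A₁} {θ₂ : Grading A₂}

instance : AddCommGroup (FermiTensor θ₁ θ₂) := inferInstanceAs (AddCommGroup (A₁ ⊗[ℂ] A₂))
instance : Module ℂ (FermiTensor θ₁ θ₂) := inferInstanceAs (Module ℂ (A₁ ⊗[ℂ] A₂))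

/-- The identification of the underlying linear spaces. -/
def ofTensor (θ₁ : Grading A₁) (θ₂ : Grading A₂) : A₁ ⊗[ℂ] A₂ ≃ₗ[ℂ] FermiTensor θ₁ θ₂ :=
  LinearEquiv.refl ℂ _

/-- The elementary tensor `a Ⓕ b`. -/
def tmul (θ₁ : Grading A₁) (θ₂ : Grading A₂) (a : A₁) (b : A₂) : FermiTensor θ₁ θ₂ :=
  ofTensor θ₁ θ₂ (a ⊗ₜ b)

instance : Mul (FermiTensor θ₁ θ₂) where
  mul x y := ofTensor θ₁ θ₂ (fermiMul θ₁ θ₂ ((ofTensor θ₁ θ₂).symm x) ((ofTensor θ₁ θ₂).symm y))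

instance : One (FermiTensor θ₁ θ₂) where
  one := tmul θ₁ θ₂ 1 1

theorem mul_def (x y : FermiTensor θ₁ θ₂) :
    x * y = ofTensor θ₁ θ₂
      (fermiMul θ₁ θ₂ ((ofTensor θ₁ θ₂).symm x) ((ofTensor θ₁ θ₂).symm y)) := rfl

theorem one_def : (1 : FermiTensor θ₁ θ₂) = tmul θ₁ θ₂ 1 1 := rfl

theorem induction_on {p : FermiTensor θ₁ θ₂ → Prop} (x : FermiTensor θ₁ θ₂) (zero : p 0)
    (tmul : ∀ a b, p (tmul θ₁ θ₂ a b)) (add : ∀ x y, p x → p y → p (x + y)) : p x :=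
  TensorProduct.induction_on (motive := fun y : A₁ ⊗[ℂ] A₂ => p (ofTensor θ₁ θ₂ y)) x zero tmul add

theorem tmul_mul_tmul (a c : A₁) (b d : A₂) :
    tmul θ₁ θ₂ a b * tmul θ₁ θ₂ c d =
      tmul θ₁ θ₂ (a * c) (θ₂.proj 1 b * d) + tmul θ₁ θ₂ (a * θ₁.auto c) (θ₂.proj (-1) b * d) :=
  fermiMul_tmul θ₁ θ₂ a c b d

theorem tmul_zero (a : A₁) : tmul θ₁ θ₂ a 0 = 0 := TensorProduct.tmul_zero _ a

theorem tmul_add (a : A₁) (b c : A₂) :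
    tmul θ₁ θ₂ a (b + c) = tmul θ₁ θ₂ a b + tmul θ₁ θ₂ a c := TensorProduct.tmul_add a b c

theorem fermi_add_mul (x y z : FermiTensor θ₁ θ₂) : (x + y) * z = x * z + y * z := by
  simp only [mul_def, map_add, LinearMap.add_apply]

theorem fermi_mul_add (x y z : FermiTensor θ₁ θ₂) : x * (y + z) = x * y + x * z := by
  simp only [mul_def, map_add]

theorem fermi_zero_mul (x : FermiTensor θ₁ θ₂) : 0 * x = 0 := by
  simp only [mul_def, map_zero, LinearMap.zero_apply]

theorem fermi_mul_zero (x : FermiTensor θ₁ θ₂) : x * 0 = 0 := by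
  simp only [mul_def, map_zero]

theorem fermi_mul_assoc (x y z : FermiTensor θ₁ θ₂) : x * y * z = x * (y * z) := by
  simp only [mul_def, LinearEquiv.symm_apply_apply, fermiMul_assoc]

theorem fermi_one_mul (x : FermiTensor θ₁ θ₂) : 1 * x = x := by
  have h := θ₂.proj_of_even (map_one θ₂.auto)
  induction x using FermiTensor.induction_on with
  | zero => exact fermi_mul_zero _
  | tmul a b =>
    rw [one_def, tmul_mul_tmul, h.1, h.2, one_mul, zero_mul, one_mul, tmul_zero, add_zero]
  | add x y hx hy => rw [fermi_mul_add, hx, hy]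

theorem fermi_mul_one (x : FermiTensor θ₁ θ₂) : x * 1 = x := by
  induction x using FermiTensor.induction_on with
  | zero => exact fermi_zero_mul _
  | tmul a b =>
    rw [one_def, tmul_mul_tmul, map_one, mul_one, mul_one, mul_one, ← tmul_add,
      θ₂.proj_add_proj]
  | add x y hx hy => rw [fermi_add_mul, hx, hy]

instance : Ring (FermiTensor θ₁ θ₂) :=
  { (inferInstance : AddCommGroup (FermiTensor θ₁ θ₂)) with
    left_distrib := fermi_mul_add
    right_distrib := fermi_add_mul
    zero_mul := fermi_zero_mul
    mul_zero := fermi_mul_zero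
    mul_assoc := fermi_mul_assoc
    one_mul := fermi_one_mul
    mul_one := fermi_mul_one }

instance : Algebra ℂ (FermiTensor θ₁ θ₂) :=
  Algebra.ofModule
    (fun r x y => by simp only [mul_def, map_smul, LinearMap.smul_apply])
    (fun r x y => by simp only [mul_def, map_smul])

instance : StarRing (FermiTensor θ₁ θ₂) where
  star x := ofTensor θ₁ θ₂ (fermiStar θ₁ θ₂ ((ofTensor θ₁ θ₂).symm x))
  star_involutive x := fermiStar_star θ₁ θ₂ x
  star_mul x y := fermiStar_mul θ₁ θ₂ x y
  star_add x y := fermiStar_add θ₁ θ₂ x y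

theorem star_tmul (a : A₁) (b : A₂) :
    star (tmul θ₁ θ₂ a b) =
      tmul θ₁ θ₂ (star a) (star (θ₂.proj 1 b)) +
        tmul θ₁ θ₂ (star (θ₁.auto a)) (star (θ₂.proj (-1) b)) :=
  fermiStar_tmul θ₁ θ₂ a b

theorem fermiStar_smul (c : ℂ) (x : A₁ ⊗[ℂ] A₂) :
    fermiStar θ₁ θ₂ (c • x) = star c • fermiStar θ₁ θ₂ x := by
  simp only [fermiStar, map_smul, star_smul, Finset.smul_sum, smul_comm (star c)]

instance : StarModule ℂ (FermiTensor θ₁ θ₂) where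
  star_smul c x := fermiStar_smul c x

/-- The grading `θ₁ Ⓕ θ₂` of the Fermi tensor product, `a Ⓕ b ↦ θ₁ a Ⓕ θ₂ b`. -/
def grading (θ₁ : Grading A₁) (θ₂ : Grading A₂) : FermiTensor θ₁ θ₂ →ₗ[ℂ] FermiTensor θ₁ θ₂ :=
  (ofTensor θ₁ θ₂).toLinearMap ∘ₗ TensorProduct.map θ₁.lin θ₂.lin ∘ₗ
    (ofTensor θ₁ θ₂).symm.toLinearMap

/-- The embedding `a ↦ a Ⓕ 1`. -/
def inl (θ₁ : Grading A₁) (θ₂ : Grading A₂) : A₁ →⋆ₐ[ℂ] FermiTensor θ₁ θ₂ where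
  toFun a := tmul θ₁ θ₂ a 1
  map_one' := rfl
  map_zero' := TensorProduct.zero_tmul _ _
  map_add' a b := TensorProduct.add_tmul a b 1
  map_mul' a b := by
    have h := θ₂.proj_of_even (map_one θ₂.auto)
    rw [tmul_mul_tmul, h.1, h.2, one_mul, zero_mul, tmul_zero, add_zero]
  commutes' r := by
    rw [Algebra.algebraMap_eq_smul_one, Algebra.algebraMap_eq_smul_one]; rfl
  map_star' a := by
    have h := θ₂.proj_of_even (map_one θ₂.auto)
    rw [star_tmul, h.1, h.2, star_one, star_zero, tmul_zero, add_zero]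

/-- The embedding `b ↦ 1 Ⓕ b`. -/
def inr (θ₁ : Grading A₁) (θ₂ : Grading A₂) : A₂ →⋆ₐ[ℂ] FermiTensor θ₁ θ₂ where
  toFun b := tmul θ₁ θ₂ 1 b
  map_one' := rfl
  map_zero' := TensorProduct.tmul_zero _ _
  map_add' a b := TensorProduct.tmul_add 1 a b
  map_mul' a b := by
    rw [tmul_mul_tmul, map_one, mul_one, ← tmul_add, ← add_mul, θ₂.proj_add_proj]
  commutes' r := by
    rw [Algebra.algebraMap_eq_smul_one, Algebra.algebraMap_eq_smul_one]
    exact TensorProduct.tmul_smul r (1 : A₁) (1 : A₂)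
  map_star' b := by
    rw [star_tmul, map_one, star_one, ← tmul_add, ← star_add, θ₂.proj_add_proj]

theorem inl_mul_inr (a : A₁) (b : A₂) : inl θ₁ θ₂ a * inr θ₁ θ₂ b = tmul θ₁ θ₂ a b := by
  have h := θ₂.proj_of_even (map_one θ₂.auto)
  change tmul θ₁ θ₂ a 1 * tmul θ₁ θ₂ 1 b = _
  rw [tmul_mul_tmul, h.1, h.2, one_mul, zero_mul, tmul_zero, add_zero, mul_one]

theorem leftBounded (φ : PositiveFunctional (FermiTensor θ₁ θ₂)) (x : FermiTensor θ₁ θ₂) :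
    φ.LeftBounded x := by
  induction x using FermiTensor.induction_on with
  | zero => exact ⟨0, fun y => by simp⟩
  | tmul a b =>
    rw [← inl_mul_inr]
    exact (PositiveFunctional.leftBounded_of_starAlgHom _ a).mul
      (PositiveFunctional.leftBounded_of_starAlgHom _ b)
  | add x y hx hy => exact hx.add hy

end FermiTensor

/-- An even state of a `ℤ₂`-graded `C*`-algebra: a positive unital functional that is invariant
under the grading. -/
structure EvenState {A : Type*} [CStarAlgebra A] (θ : Grading A) extends PositiveFunctional A where
  map_one' : toFun 1 = 1
  even' : ∀ a, toFun (θ.auto a) = toFun a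

namespace FermiTensor

variable {θ₁ : Grading A₁} {θ₂ : Grading A₂}

/-- The product functional `a Ⓕ b ↦ ω₁ a * ω₂ b`. -/
def productFunctional (ω₁ : EvenState θ₁) (ω₂ : EvenState θ₂) : FermiTensor θ₁ θ₂ →ₗ[ℂ] ℂ :=
  LinearMap.mul' ℂ ℂ ∘ₗ TensorProduct.map ω₁.toLinearMap ω₂.toLinearMap ∘ₗ
    (ofTensor θ₁ θ₂).symm.toLinearMap

theorem productFunctional_tmul (ω₁ : EvenState θ₁) (ω₂ : EvenState θ₂) (a : A₁) (b : A₂) :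
    productFunctional ω₁ ω₂ (tmul θ₁ θ₂ a b) = ω₁.toLinearMap a * ω₂.toLinearMap b := rfl

def toGNS (ω₁ : EvenState θ₁) (ω₂ : EvenState θ₂) :
    FermiTensor θ₁ θ₂ →ₗ[ℂ] ω₁.GNS ⊗[ℂ] ω₂.GNS :=
  TensorProduct.map
    ((Completion.toComplₗᵢ (𝕜 := ℂ)).toLinearMap ∘ₗ ω₁.toPre.toLinearMap)
    ((Completion.toComplₗᵢ (𝕜 := ℂ)).toLinearMap ∘ₗ ω₂.toPre.toLinearMap) ∘ₗ
    (ofTensor θ₁ θ₂).symm.toLinearMap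

theorem inner_toGNS (ω₁ : EvenState θ₁) (ω₂ : EvenState θ₂) (x y : FermiTensor θ₁ θ₂) :
    productFunctional ω₁ ω₂ (star x * y) = ⟪toGNS ω₁ ω₂ x, toGNS ω₁ ω₂ y⟫_ℂ := by
  induction x using FermiTensor.induction_on with
  | zero => rw [star_zero, zero_mul, map_zero, map_zero, inner_zero_left]
  | add x x' hx hx' => rw [star_add, add_mul, map_add, map_add, inner_add_left, hx, hx']
  | tmul a b =>
    induction y using FermiTensor.induction_on with
    | zero => rw [mul_zero, map_zero, map_zero, inner_zero_right]
    | add y y' hy hy' => rw [mul_add, map_add, map_add, inner_add_right, hy, hy']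
    | tmul c d =>
      have e := θ₂.proj_of_even (θ₂.auto_proj_one b)
      have o := θ₂.proj_of_odd (θ₂.auto_proj_neg_one b)
      have hr : ⟪toGNS ω₁ ω₂ (tmul θ₁ θ₂ a b), toGNS ω₁ ω₂ (tmul θ₁ θ₂ c d)⟫_ℂ =
          ω₁.toLinearMap (star a * c) * ω₂.toLinearMap (star b * d) := by
        change ⟪((ω₁.toPre a : ω₁.GNS) ⊗ₜ[ℂ] (ω₂.toPre b : ω₂.GNS)),
          ((ω₁.toPre c : ω₁.GNS) ⊗ₜ[ℂ] (ω₂.toPre d : ω₂.GNS))⟫_ℂ = _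
        rw [TensorProduct.inner_tmul, Completion.inner_coe, Completion.inner_coe]
        rfl
      have hev : ω₁.toLinearMap (star (θ₁.auto a) * θ₁.auto c) =
          ω₁.toLinearMap (star a * c) := by
        rw [← map_star, ← map_mul]; exact ω₁.even' _
      rw [hr, star_tmul, add_mul, tmul_mul_tmul, tmul_mul_tmul]
      simp only [Grading.proj_star, e.1, e.2, o.1, o.2, star_zero, zero_mul, tmul_zero, add_zero,
        zero_add, map_add, productFunctional_tmul, hev]
      rw [← mul_add, ← map_add, ← add_mul, ← star_add, θ₂.proj_add_proj]

/-- The product state `ω₁ × ω₂` of two even states. -/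
def productState (ω₁ : EvenState θ₁) (ω₂ : EvenState θ₂) :
    PositiveFunctional (FermiTensor θ₁ θ₂) where
  toLinearMap := productFunctional ω₁ ω₂
  nonneg' x := by
    change 0 ≤ productFunctional ω₁ ω₂ (star x * x)
    have h := inner_self_eq_norm_sq_to_K (𝕜 := ℂ) (toGNS ω₁ ω₂ x)
    rw [inner_toGNS]
    refine le_of_le_of_eq ?_ h.symm
    positivity

/-- The spatial norm: the supremum of `‖π_{ω₁ × ω₂}(x)‖` over all pairs of even states. -/
def spatialNorm (x : FermiTensor θ₁ θ₂) : ℝ :=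
  ⨆ ω : EvenState θ₁ × EvenState θ₂,
    ‖(productState ω.1 ω.2).gnsRep (leftBounded _) x‖

/-- A `C*`-norm is a cross norm if `β (a Ⓕ b) = ‖a‖ ‖b‖` for homogeneous `a` and `b`. -/
def IsCross (β : CStarNorm (FermiTensor θ₁ θ₂)) : Prop :=
  ∀ a b, θ₁.IsHomogeneous a → θ₂.IsHomogeneous b → β (tmul θ₁ θ₂ a b) = ‖a‖ * ‖b‖

/-- A `C*`-norm is compatible if the grading `θ₁ Ⓕ θ₂` extends to a `*`-automorphism of the
completion. -/
def IsCompatible (β : CStarNorm (FermiTensor θ₁ θ₂)) : Prop :=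
  ∃ Θ : β.Completion ≃⋆ₐ[ℂ] β.Completion,
    ∀ x, Θ (β.toCompletion x) = β.toCompletion (grading θ₁ θ₂ x)

end FermiTensor

end Fermi

end

/-!
Let `D` be the completion for `β`, and let `A₂` be the commutative factor.

Upper bound: multiplication by even bump functions concentrating at a character `χ` of `A₂`,
together with the cross property, shows `‖∑ χ (b i) • a i‖ ≤ β (∑ a i ⊗ b i)` for even `a i` and
`b i`. So `ω₁ ⊗ χ`, restricted to the products of even elements, extends to a state of `D`, and
averaging gives a product of even states there. As characters attain the norm of `A₂`, every product
of even states is bounded by `β`, so it extends to a state of `D` and its GNS norm is at most `β`.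

Lower bound: the even part of `A₂` is central in `D`, so a character of the commutative subalgebra
it generates with `x⋆ * x` extends to a state of `D` that attains `‖x‖²` at `x⋆ * x` and is
multiplicative on the even part. Averaging that state over the grading automorphism and over the
twist by an odd element gives a product of even states which dominates a quarter of the state, and
domination of states passes to the GNS norms.
-/

open scoped NNReal InnerProduct

noncomputable section

section Intertwiner

variable {H K : Type*} [NormedAddCommGroup H] [InnerProductSpace ℂ H] [CompleteSpace H]
  [NormedAddCommGroup K] [InnerProductSpace ℂ K] [CompleteSpace K]

theorem norm_sqrt_adjoint_comp_self_apply (T : H →L[ℂ] K) (v : H) :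
    ‖CFC.sqrt (T† ∘L T) v‖ = ‖T v‖ := by
  have hpos : 0 ≤ T† ∘L T :=
    (ContinuousLinearMap.nonneg_iff_isPositive _).2
      (ContinuousLinearMap.isPositive_adjoint_comp_self T)
  have hsq : (CFC.sqrt (T† ∘L T))† ∘L CFC.sqrt (T† ∘L T) = T† ∘L T := by
    rw [(CFC.sqrt_nonneg (T† ∘L T)).isSelfAdjoint.adjoint_eq]
    exact CFC.sqrt_mul_sqrt_self _ hpos
  rw [← sq_eq_sq₀ (norm_nonneg _) (norm_nonneg _),
    ContinuousLinearMap.apply_norm_sq_eq_inner_adjoint_left, hsq,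
    ← ContinuousLinearMap.apply_norm_sq_eq_inner_adjoint_left]

/-- The positive part of `T` in its polar decomposition commutes with `x`. -/
theorem norm_le_norm_of_intertwining {T : H →L[ℂ] K} (hT : DenseRange T) {x : H →L[ℂ] H}
    {y : K →L[ℂ] K} (h : T ∘L x = y ∘L T) (hadj : T ∘L x† = y† ∘L T) : ‖y‖ ≤ ‖x‖ := by
  have hadj' : x ∘L T† = T† ∘L y := by
    simpa only [ContinuousLinearMap.adjoint_comp, ContinuousLinearMap.adjoint_adjoint] using
      congrArg ContinuousLinearMap.adjoint hadj
  have hcomm : Commute (T† ∘L T) x := by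
    change (T† ∘L T) ∘L x = x ∘L (T† ∘L T)
    rw [ContinuousLinearMap.comp_assoc, h, ← ContinuousLinearMap.comp_assoc, ← hadj',
      ContinuousLinearMap.comp_assoc]
  have hsqrt : Commute (CFC.sqrt (T† ∘L T)) x := hcomm.cfcₙ_nnreal _
  refine ContinuousLinearMap.opNorm_le_bound _ (norm_nonneg _) fun w => ?_
  induction w using hT.induction_on with
  | hp => exact isClosed_le (by fun_prop) (by fun_prop)
  | ih v =>
    calc ‖y (T v)‖ = ‖T (x v)‖ := congrArg norm (DFunLike.congr_fun h v).symm
      _ = ‖x (CFC.sqrt (T† ∘L T) v)‖ := by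
        rw [← norm_sqrt_adjoint_comp_self_apply]
        exact congrArg norm (DFunLike.congr_fun hsqrt v)
      _ ≤ ‖x‖ * ‖T v‖ := by
        rw [← norm_sqrt_adjoint_comp_self_apply T v]
        exact x.le_opNorm _

end Intertwiner

namespace PositiveFunctional

section Basic

variable {F : Type*} [Ring F] [StarRing F] [Algebra ℂ F]

instance : CoeFun (PositiveFunctional F) fun _ => F → ℂ := ⟨fun φ => φ.toLinearMap⟩

@[ext]
theorem ext {φ ψ : PositiveFunctional F} (h : ∀ x, φ x = ψ x) : φ = ψ := by
  obtain ⟨f, _⟩ := φ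
  obtain ⟨g, _⟩ := ψ
  congr
  exact LinearMap.ext h

instance : Add (PositiveFunctional F) where
  add φ ψ := ⟨φ.toLinearMap + ψ.toLinearMap, fun x => add_nonneg (φ.nonneg x) (ψ.nonneg x)⟩

instance : SMul ℝ≥0 (PositiveFunctional F) where
  smul r φ := ⟨(r : ℂ) • φ.toLinearMap, fun x => mul_nonneg (by positivity) (φ.nonneg x)⟩

theorem add_apply (φ ψ : PositiveFunctional F) (x : F) : (φ + ψ) x = φ x + ψ x := rfl

theorem smul_apply (r : ℝ≥0) (φ : PositiveFunctional F) (x : F) : (r • φ) x = r * φ x := rfl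

/-- The pullback of a positive functional along a `*`-homomorphism. -/
def comp {E : Type*} [Ring E] [StarRing E] [Algebra ℂ E] (φ : PositiveFunctional F)
    (f : E →⋆ₐ[ℂ] F) : PositiveFunctional E where
  toLinearMap := φ.toLinearMap ∘ₗ f.toAlgHom.toLinearMap
  nonneg' x := by
    change 0 ≤ φ (f (star x * x))
    rw [map_mul, map_star]
    exact φ.nonneg _

theorem comp_apply {E : Type*} [Ring E] [StarRing E] [Algebra ℂ E] (φ : PositiveFunctional F)
    (f : E →⋆ₐ[ℂ] F) (x : E) : φ.comp f x = φ (f x) := rfl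

/-- The positive functional `x ↦ φ (b* x b)`. -/
def conj (φ : PositiveFunctional F) (b : F) : PositiveFunctional F where
  toLinearMap := φ.toLinearMap ∘ₗ LinearMap.mulLeft ℂ (star b) ∘ₗ LinearMap.mulRight ℂ b
  nonneg' x := by
    change 0 ≤ φ (star b * (star x * x * b))
    rw [mul_assoc, ← mul_assoc, ← star_mul]
    exact φ.nonneg _

theorem conj_apply (φ : PositiveFunctional F) (b x : F) : φ.conj b x = φ (star b * (x * b)) := rfl

end Basic

section GNSRepresentation

variable {F : Type*} [Ring F] [StarRing F] [Algebra ℂ F] [StarModule ℂ F]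
  {φ ψ : PositiveFunctional F}

theorem norm_toPre_le_mul_norm_toPre {K : ℝ} (hK : 0 ≤ K) {z : F}
    (h : φ (star z * z) ≤ K ^ 2 * ψ (star z * z)) : ‖φ.toPre z‖ ≤ K * ‖ψ.toPre z‖ := by
  rw [← sq_le_sq₀ (norm_nonneg _) (by positivity), mul_pow, norm_toPre_sq, norm_toPre_sq,
    ← Complex.re_ofReal_mul]
  exact_mod_cast (Complex.le_def.1 h).1

theorem norm_apply_star_mul_le (φ : PositiveFunctional F) (x y : F) :
    ‖φ (star x * y)‖ ≤ ‖φ.toPre x‖ * ‖φ.toPre y‖ :=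
  norm_inner_le_norm (φ.toPre x) (φ.toPre y)

theorem apply_mul_eq_zero {y : F} (hy : φ (star y * y) = 0) (x : F) : φ (x * y) = 0 := by
  have hy' : ‖φ.toPre y‖ = 0 := by rw [← sq_eq_zero_iff, norm_toPre_sq, hy, Complex.zero_re]
  have h := φ.norm_apply_star_mul_le (star x) y
  rwa [star_star, hy', mul_zero, norm_le_zero_iff] at h

/-- The right multiplicative domain of a state: `c - φ c` is a null vector. -/
theorem apply_mul_of_apply_star_mul_self (hφ : φ 1 = 1) {c : F}
    (hc : φ (star c * c) = star (φ c) * φ c) (y : F) : φ (y * c) = φ y * φ c := by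
  have h := φ.apply_mul_eq_zero (y := c - φ c • 1) (by
    simp only [star_sub, star_smul, star_one, sub_mul, mul_sub, mul_smul_comm, smul_mul_assoc,
      mul_one, one_mul, map_sub, map_smul, hc, φ.apply_star, smul_eq_mul, hφ]
    ring) y
  rwa [mul_sub, mul_smul_comm, mul_one, map_sub, map_smul, smul_eq_mul, sub_eq_zero,
    mul_comm] at h

theorem gnsRep_toPre (hφ : ∀ x, φ.LeftBounded x) (x y : F) :
    φ.gnsRep hφ x (φ.toPre y : φ.GNS) = (φ.toPre (x * y) : φ.GNS) :=
  ContinuousLinearMap.completion_apply_coe _ _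

theorem norm_apply_le_norm_gnsRep (hφ : ∀ x, φ.LeftBounded x) (h1 : φ 1 = 1) (x : F) :
    ‖φ x‖ ≤ ‖φ.gnsRep hφ x‖ := by
  have hone : ‖(φ.toPre 1 : φ.GNS)‖ = 1 := by
    rw [Completion.norm_coe, ← sq_eq_sq₀ (norm_nonneg _) zero_le_one, norm_toPre_sq, star_one,
      one_mul, h1, Complex.one_re, one_pow]
  calc ‖φ x‖ = ‖⟪(φ.toPre 1 : φ.GNS), φ.gnsRep hφ x (φ.toPre 1 : φ.GNS)⟫_ℂ‖ := by
        rw [gnsRep_toPre, Completion.inner_coe, inner_toPre, star_one, one_mul, mul_one]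
    _ ≤ ‖φ.gnsRep hφ x (φ.toPre 1 : φ.GNS)‖ := by
        simpa only [hone, one_mul] using
          norm_inner_le_norm (φ.toPre 1 : φ.GNS) (φ.gnsRep hφ x (φ.toPre 1 : φ.GNS))
    _ ≤ ‖φ.gnsRep hφ x‖ := by
        simpa only [hone, mul_one] using (φ.gnsRep hφ x).le_opNorm (φ.toPre 1 : φ.GNS)

theorem norm_toPre_mul_le (hφ : ∀ x, φ.LeftBounded x) (x y : F) :
    ‖φ.toPre (x * y)‖ ≤ ‖φ.gnsRep hφ x‖ * ‖φ.toPre y‖ := by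
  simpa only [gnsRep_toPre, Completion.norm_coe] using
    (φ.gnsRep hφ x).le_opNorm (φ.toPre y : φ.GNS)

theorem norm_gnsRep_le (hφ : ∀ x, φ.LeftBounded x) {x : F} {M : ℝ} (hM : 0 ≤ M)
    (h : ∀ y, ‖φ.toPre (x * y)‖ ≤ M * ‖φ.toPre y‖) : ‖φ.gnsRep hφ x‖ ≤ M := by
  refine ContinuousLinearMap.opNorm_le_bound _ hM fun z => ?_
  induction z using Completion.induction_on with
  | hp => exact isClosed_le (by fun_prop) (by fun_prop)
  | ih z =>
    obtain ⟨y, rfl⟩ := φ.toPre.surjective z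
    simpa only [gnsRep_toPre, Completion.norm_coe] using h y

theorem norm_gnsRep_le_of_norm_toPre_le (hφ : ∀ x, φ.LeftBounded x) (hψ : ∀ x, ψ.LeftBounded x)
    {K : ℝ} (h : ∀ z, ‖φ.toPre z‖ ≤ K * ‖ψ.toPre z‖) (x : F) :
    ‖φ.gnsRep hφ x‖ ≤ ‖ψ.gnsRep hψ x‖ := by
  let T : ψ.PreGNS →L[ℂ] φ.PreGNS :=
    (φ.toPre.toLinearMap ∘ₗ ψ.toPre.symm.toLinearMap).mkContinuous K fun z => h (ψ.toPre.symm z)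
  have hT (y : F) : T.completion (ψ.toPre y : ψ.GNS) = (φ.toPre y : φ.GNS) :=
    ContinuousLinearMap.completion_apply_coe _ _
  have hdense : DenseRange T.completion := by
    refine (Completion.denseRange_coe (α := φ.PreGNS)).mono ?_
    rintro _ ⟨z, rfl⟩
    obtain ⟨y, rfl⟩ := φ.toPre.surjective z
    exact ⟨_, hT y⟩
  have intertwines (x : F) : T.completion ∘L ψ.gnsRep hψ x = φ.gnsRep hφ x ∘L T.completion := by
    ext z
    induction z using Completion.induction_on with
    | hp => exact isClosed_eq (by fun_prop) (by fun_prop)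
    | ih z =>
      obtain ⟨y, rfl⟩ := ψ.toPre.surjective z
      simp only [ContinuousLinearMap.comp_apply, gnsRep_toPre, hT]
  refine norm_le_norm_of_intertwining hdense (intertwines x) ?_
  have hstar := intertwines (star x)
  rwa [map_star, map_star] at hstar

end GNSRepresentation

end PositiveFunctional

section UnitalContraction

variable {B : Type*} [CStarAlgebra B]

theorem norm_algebraMap_norm_sub_le (x : B) :
    ‖algebraMap ℝ B ‖star x * x‖ - star x * x‖ ≤ ‖star x * x‖ := by
  let _ := CStarAlgebra.spectralOrder B
  let _ := CStarAlgebra.spectralOrderedRing B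
  have h : 0 ≤ algebraMap ℝ B ‖star x * x‖ - star x * x :=
    sub_nonneg.2 (IsSelfAdjoint.star_mul_self x).le_algebraMap_norm_self
  rw [CStarAlgebra.norm_le_iff_le_algebraMap _ (norm_nonneg _) h]
  exact sub_le_self _ (star_mul_self_nonneg x)

variable [Nontrivial B] {a : B}

theorem norm_add_ofReal_mul_I_smul_one_sq_le (ha : IsSelfAdjoint a) (t : ℝ) :
    ‖a + (t * Complex.I) • (1 : B)‖ ^ 2 ≤ ‖a‖ ^ 2 + t ^ 2 := by
  have h : star (a + (t * Complex.I) • (1 : B)) * (a + (t * Complex.I) • 1) =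
      a * a + ((t ^ 2 : ℝ) : ℂ) • 1 := by
    simp only [star_add, star_smul, star_one, ha.star_eq, add_mul, mul_add, mul_one, one_mul,
      smul_mul_assoc, mul_smul_comm, star_mul', Complex.star_def, Complex.conj_I,
      Complex.conj_ofReal, Complex.ofReal_pow]
    match_scalars <;> ring_nf
    simp
  calc ‖a + (t * Complex.I) • (1 : B)‖ ^ 2 = ‖a * a + ((t ^ 2 : ℝ) : ℂ) • (1 : B)‖ := by
        rw [sq, ← CStarRing.norm_star_mul_self, h]
    _ ≤ ‖a * a‖ + ‖((t ^ 2 : ℝ) : ℂ) • (1 : B)‖ := norm_add_le _ _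
    _ ≤ ‖a‖ ^ 2 + t ^ 2 := by
        rw [norm_smul, norm_one, mul_one, Complex.norm_real, Real.norm_of_nonneg (sq_nonneg t),
          sq ‖a‖]
        gcongr
        exact norm_mul_le _ _

variable {f : B →ₗ[ℂ] ℂ}

/-- Comparing `|f (a + i t)|²` with `‖a + i t‖² ≤ ‖a‖² + t²` for large `t`. -/
theorem im_apply_eq_zero_of_norm_le (hf : ∀ x, ‖f x‖ ≤ ‖x‖) (h1 : f 1 = 1)
    (ha : IsSelfAdjoint a) : (f a).im = 0 := by
  have key (t : ℝ) : 2 * (t * (f a).im) ≤ ‖a‖ ^ 2 := by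
    have ht : ‖f (a + (t * Complex.I) • 1)‖ ^ 2 ≤ ‖a‖ ^ 2 + t ^ 2 :=
      (pow_le_pow_left₀ (norm_nonneg _) (hf _) 2).trans (norm_add_ofReal_mul_I_smul_one_sq_le ha t)
    have him : ((f a).im + t) ^ 2 ≤ ‖f (a + (t * Complex.I) • 1)‖ ^ 2 := by
      refine sq_le_sq.2 ((Complex.abs_im_le_norm _).trans' (le_of_eq ?_) |>.trans (le_abs_self _))
      simp [h1]
    nlinarith [sq_nonneg (f a).im]
  by_contra hne
  have h := key ((‖a‖ ^ 2 + 1) / (f a).im)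
  rw [div_mul_cancel₀ _ hne] at h
  nlinarith [sq_nonneg ‖a‖]

theorem apply_star_mul_self_nonneg_of_norm_le (hf : ∀ x, ‖f x‖ ≤ ‖x‖) (h1 : f 1 = 1) (x : B) :
    0 ≤ f (star x * x) := by
  refine Complex.nonneg_iff.2
    ⟨?_, (im_apply_eq_zero_of_norm_le hf h1 (IsSelfAdjoint.star_mul_self x)).symm⟩
  have h := (Complex.re_le_norm _).trans ((hf _).trans (norm_algebraMap_norm_sub_le x))
  rw [map_sub, IsScalarTower.algebraMap_apply ℝ ℂ B, Algebra.algebraMap_eq_smul_one, map_smul, h1,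
    smul_eq_mul, mul_one, Complex.coe_algebraMap, Complex.sub_re, Complex.ofReal_re] at h
  linarith

end UnitalContraction

namespace PositiveFunctional

variable {B : Type*} [CStarAlgebra B] {F : Type*} [Ring F] [StarRing F] [Algebra ℂ F]
  [StarModule ℂ F]

theorem leftBounded (φ : PositiveFunctional B) (x : B) : φ.LeftBounded x :=
  leftBounded_of_starAlgHom (StarAlgHom.id ℂ B) x

theorem norm_toPre_comp (φ : PositiveFunctional B) (f : F →⋆ₐ[ℂ] B) (y : F) :
    ‖(φ.comp f).toPre y‖ = ‖φ.toPre (f y)‖ := by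
  rw [← sq_eq_sq₀ (norm_nonneg _) (norm_nonneg _), norm_toPre_sq, norm_toPre_sq, comp_apply,
    map_mul, map_star]

theorem norm_gnsRep_comp_le {φ : PositiveFunctional B} {f : F →⋆ₐ[ℂ] B}
    (h : ∀ x, (φ.comp f).LeftBounded x) (x : F) : ‖(φ.comp f).gnsRep h x‖ ≤ ‖f x‖ := by
  refine norm_gnsRep_le h (norm_nonneg _) fun y => ?_
  rw [norm_toPre_comp, norm_toPre_comp, map_mul]
  exact (norm_toPre_mul_le φ.leftBounded _ _).trans <|
    mul_le_mul_of_nonneg_right (NonUnitalStarAlgHom.norm_apply_le (φ.gnsRep φ.leftBounded) _)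
      (norm_nonneg _)

theorem norm_apply_le {φ : PositiveFunctional B} (h1 : φ 1 = 1) (x : B) : ‖φ x‖ ≤ ‖x‖ :=
  (norm_apply_le_norm_gnsRep φ.leftBounded h1 x).trans
    (NonUnitalStarAlgHom.norm_apply_le (φ.gnsRep φ.leftBounded) x)

theorem exists_extension {V : Type*} [AddCommGroup V] [Module ℂ V] (T : V →ₗ[ℂ] B)
    (Q : V →ₗ[ℂ] ℂ) (hQ : ∀ v, ‖Q v‖ ≤ ‖T v‖) {v₀ : V} (hT₀ : T v₀ = 1) (hQ₀ : Q v₀ = 1) :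
    ∃ φ : PositiveFunctional B, φ 1 = 1 ∧ ∀ v, φ (T v) = Q v := by
  have hker : Q ∈ (T.rangeRestrict.ker).dualAnnihilator := by
    rw [Submodule.mem_dualAnnihilator, LinearMap.ker_rangeRestrict]
    intro v hv
    simpa only [LinearMap.mem_ker.1 hv, norm_zero, norm_le_zero_iff] using hQ v
  rw [← LinearMap.range_dualMap_eq_dualAnnihilator_ker] at hker
  obtain ⟨f, rfl⟩ := hker
  have hf (w : T.range) : ‖f w‖ ≤ 1 * ‖w‖ := by
    obtain ⟨v, rfl⟩ := T.surjective_rangeRestrict w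
    exact (hQ v).trans_eq (one_mul _).symm
  obtain ⟨g, hg, hgn⟩ := exists_extension_norm_eq _ (f.mkContinuous 1 hf)
  have hg1 : g 1 = 1 := by
    rw [← hQ₀, ← hT₀]
    exact hg (T.rangeRestrict v₀)
  have hgle (x : B) : ‖g x‖ ≤ ‖x‖ :=
    (g.le_of_opNorm_le (hgn ▸ f.mkContinuous_norm_le zero_le_one hf) x).trans_eq (one_mul _)
  have : Nontrivial B := nontrivial_of_ne 1 0 fun h => by simp [h] at hg1
  exact ⟨⟨g.toLinearMap, apply_star_mul_self_nonneg_of_norm_le hgle hg1⟩, hg1,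
    fun v => hg (T.rangeRestrict v)⟩

end PositiveFunctional

theorem exists_character_norm_eq {C : Type*} [CommCStarAlgebra C] [Nontrivial C] (y : C) :
    ∃ τ : C →⋆ₐ[ℂ] ℂ, ‖τ y‖ = ‖y‖ := by
  obtain ⟨z, hz, hzy⟩ := spectrum.exists_nnnorm_eq_spectralRadius (A := C) y
  rw [IsStarNormal.spectralRadius_eq_nnnorm, ENNReal.coe_inj] at hzy
  obtain ⟨τ, rfl⟩ := WeakDual.CharacterSpace.mem_spectrum_iff_exists.1 hz
  exact ⟨⟨WeakDual.CharacterSpace.toAlgHom τ, map_star τ⟩, congrArg NNReal.toReal hzy⟩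

theorem PositiveFunctional.exists_multiplicativeOn {B : Type*} [CStarAlgebra B] [Nontrivial B]
    {S : Set B} (hstar : star S = S) (hcomm : ∀ x ∈ S, ∀ y ∈ S, x * y = y * x) {h : B}
    (hh : h ∈ S) :
    ∃ φ : PositiveFunctional B, φ 1 = 1 ∧ (∀ c ∈ S, φ (star c * c) = star (φ c) * φ c) ∧
      ‖φ h‖ = ‖h‖ := by
  let D := StarSubalgebra.centralizer ℂ (StarSubalgebra.centralizer ℂ S : Set B)
  have hD : (D : Set B) = S.centralizer.centralizer := by
    rw [StarSubalgebra.coe_centralizer_centralizer, hstar, Set.union_self]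
  have hSD {x : B} (hx : x ∈ S) : x ∈ D := by
    rw [← SetLike.mem_coe, hD]
    exact Set.subset_centralizer_centralizer hx
  have : IsClosed (D : Set B) := hD ▸ Set.isClosed_centralizer _
  let _ : CommCStarAlgebra D :=
    { (inferInstance : CStarAlgebra D) with
      mul_comm := fun x y => Subtype.ext
        (Set.centralizer_centralizer_comm_of_comm hcomm _ (hD ▸ x.2) _ (hD ▸ y.2)) }
  obtain ⟨τ, hτ⟩ := exists_character_norm_eq (⟨h, hSD hh⟩ : D)
  obtain ⟨φ, hφ1, hφ⟩ := exists_extension D.subtype.toAlgHom.toLinearMap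
    τ.toAlgHom.toLinearMap (v₀ := 1) (NonUnitalStarAlgHom.norm_apply_le τ) rfl (map_one τ)
  refine ⟨φ, hφ1, fun c hc => ?_, (congrArg norm (hφ ⟨h, hSD hh⟩)).trans hτ⟩
  let d : D := ⟨c, hSD hc⟩
  calc φ (star c * c) = τ (star d * d) := hφ (star d * d)
    _ = star (τ d) * τ d := by rw [map_mul, map_star]
    _ = star (φ c) * φ c := by rw [← show φ c = τ d from hφ d]

section Bump

variable {C : Type*} [CStarAlgebra C] {ι : Type*} {s : Finset ι}

theorem norm_mul_sq_le_norm_star_mul_sum_mul (u : ι → C) (e : C) {k : ι} (hk : k ∈ s) :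
    ‖u k * e‖ ^ 2 ≤ ‖star e * (∑ j ∈ s, star (u j) * u j) * e‖ := by
  let _ := CStarAlgebra.spectralOrder C
  let _ := CStarAlgebra.spectralOrderedRing C
  have hle : star (u k) * u k ≤ ∑ j ∈ s, star (u j) * u j :=
    Finset.single_le_sum (f := fun j => star (u j) * u j) (fun j _ => star_mul_self_nonneg _) hk
  rw [sq, ← CStarRing.norm_star_mul_self]
  refine CStarAlgebra.norm_le_norm_of_nonneg_of_le (star_mul_self_nonneg _) ?_
  calc star (u k * e) * (u k * e) = star e * (star (u k) * u k) * e := by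
        rw [star_mul]; noncomm_ring
    _ ≤ star e * (∑ j ∈ s, star (u j) * u j) * e := star_left_conjugate_le_conjugate hle e

theorem exists_continuous_bump {ε : ℝ} (hε : 0 < ε) : ∃ b : ℝ → ℝ, Continuous b ∧ b 0 = 1 ∧
    ∀ t, 0 ≤ t → ‖b t‖ ≤ 1 ∧ ‖b t * t * b t‖ ≤ ε := by
  refine ⟨fun t => Real.exp (-(t / ε)), by fun_prop, by simp, fun t ht => ?_⟩
  have hle : Real.exp (-(t / ε)) ≤ 1 := Real.exp_le_one_iff.2 (neg_nonpos.2 (by positivity))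
  have hmul : t * Real.exp (-(t / ε)) ≤ ε := by
    rw [Real.exp_neg, mul_inv_le_iff₀ (Real.exp_pos _), ← div_le_iff₀' hε]
    linarith [Real.add_one_le_exp (t / ε)]
  rw [Real.norm_of_nonneg (by positivity), Real.norm_of_nonneg (by positivity), mul_assoc]
  exact ⟨hle, (mul_le_of_le_one_left (by positivity) hle).trans hmul⟩

/-- The element `e` is a bump function, at the point `0` of its spectrum, of `∑ k, (u k)* (u k)`. -/
theorem exists_even_bump (θ : Grading C) (τ : C →⋆ₐ[ℂ] ℂ) {u : ι → C}
    (hu : ∀ k ∈ s, θ.auto (u k) = u k) (hτ : ∀ k ∈ s, τ (u k) = 0) {δ : ℝ} (hδ : 0 < δ) :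
    ∃ e, θ.auto e = e ∧ ‖e‖ ≤ 1 ∧ τ e = 1 ∧ ∀ k ∈ s, ‖u k * e‖ ≤ δ := by
  let _ := CStarAlgebra.spectralOrder C
  let _ := CStarAlgebra.spectralOrderedRing C
  let m : C := ∑ k ∈ s, star (u k) * u k
  have hm : 0 ≤ m := Finset.sum_nonneg fun k _ => star_mul_self_nonneg (u k)
  have hsa : IsSelfAdjoint m := hm.isSelfAdjoint
  have hθ : θ.auto m = m := by
    rw [map_sum]
    exact Finset.sum_congr rfl fun k hk => by rw [map_mul, map_star, hu k hk]
  have hτm : τ m = 0 := by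
    rw [map_sum]
    exact Finset.sum_eq_zero fun k hk => by rw [map_mul, hτ k hk, mul_zero]
  obtain ⟨b, hb, hb0, hbt⟩ := exists_continuous_bump (sq_pos_of_pos hδ)
  have hspec {t : ℝ} (ht : t ∈ spectrum ℝ m) : 0 ≤ t := spectrum_nonneg_of_nonneg hm ht
  refine ⟨cfc b m, ?_, norm_cfc_le zero_le_one fun t ht => (hbt t (hspec ht)).1, ?_,
    fun k hk => ?_⟩
  · have hcont : Continuous θ.auto := (StarAlgEquiv.isometry θ.auto).continuous
    rw [StarAlgHomClass.map_cfc θ.auto b m hb.continuousOn hcont hsa (hsa.map θ.auto), hθ]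
  · rw [StarAlgHomClass.map_cfc τ b m hb.continuousOn (map_continuous τ) hsa (hsa.map τ), hτm,
      cfc_apply_zero, hb0, map_one]
  · have hcfc : star (cfc b m) * m * cfc b m = cfc (fun t => b t * t * b t) m := by
      rw [(cfc_predicate b m : IsSelfAdjoint (cfc b m)).star_eq, cfc_mul (fun t => b t * t) b m,
        cfc_mul b (fun t => t) m, cfc_id' ℝ m]
    refine (sq_le_sq₀ (norm_nonneg _) hδ.le).1 ?_
    calc ‖u k * cfc b m‖ ^ 2 ≤ ‖star (cfc b m) * m * cfc b m‖ :=
          norm_mul_sq_le_norm_star_mul_sum_mul u (cfc b m) hk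
      _ ≤ δ ^ 2 := hcfc ▸ norm_cfc_le (sq_nonneg δ) fun t ht => (hbt t (hspec ht)).2

end Bump

namespace EvenState

variable {A : Type*} [CStarAlgebra A] {θ : Grading A}

instance : CoeFun (EvenState θ) fun _ => A → ℂ := ⟨fun ω => ω.toLinearMap⟩

theorem apply_one (ω : EvenState θ) : ω 1 = 1 := ω.map_one'

theorem apply_proj_one (ω : EvenState θ) (a : A) : ω (θ.proj 1 a) = ω a := by
  have heven : ω (θ.auto a) = ω a := ω.even' a
  rw [θ.proj_apply, map_smul, map_add, map_smul, heven, Units.val_one, Int.cast_one, one_smul,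
    smul_eq_mul, ← two_mul, inv_mul_cancel_left₀ two_ne_zero]

/-- The even state obtained by pulling a state `φ` back along `f` and averaging over the grading
automorphism. -/
def ofState {F : Type*} [Ring F] [StarRing F] [Algebra ℂ F] (φ : PositiveFunctional F)
    (hφ : φ 1 = 1) (θ : Grading A) (f : A →⋆ₐ[ℂ] F) : EvenState θ where
  toPositiveFunctional := (2⁻¹ : ℝ≥0) • (φ.comp f + φ.comp (f.comp (θ.auto : A →⋆ₐ[ℂ] A)))
  map_one' := by
    change (2⁻¹ : ℝ≥0) * (φ (f 1) + φ (f (θ.auto 1))) = (1 : ℂ)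
    rw [map_one θ.auto, map_one f, hφ]
    norm_num
  even' a := by
    change (2⁻¹ : ℝ≥0) * (φ (f (θ.auto a)) + φ (f (θ.auto (θ.auto a)))) =
      (2⁻¹ : ℝ≥0) * (φ (f a) + φ (f (θ.auto a)))
    rw [θ.involutive, add_comm]

theorem ofState_apply {F : Type*} [Ring F] [StarRing F] [Algebra ℂ F] (φ : PositiveFunctional F)
    (hφ : φ 1 = 1) (θ : Grading A) (f : A →⋆ₐ[ℂ] F) (a : A) :
    ofState φ hφ θ f a = φ (f (θ.proj 1 a)) := by
  change (2⁻¹ : ℝ≥0) * (φ (f a) + φ (f (θ.auto a))) = φ (f (θ.proj 1 a))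
  rw [θ.proj_apply, map_smul, map_smul, map_add, map_add, Units.val_one, Int.cast_one, one_smul,
    smul_eq_mul]
  norm_num

end EvenState

/-- Two `ℤ₂`-graded `C*`-algebras mapped into a `*`-algebra `F` in such a way that their images
commute in the graded sense. -/
structure GradedPair {A C : Type*} [CStarAlgebra A] [CStarAlgebra C] (θA : Grading A)
    (θC : Grading C) (F : Type*) [Ring F] [StarRing F] [Algebra ℂ F] where
  left : A →⋆ₐ[ℂ] F
  right : C →⋆ₐ[ℂ] F
  even_comm : ∀ a c, θC.auto c = c → right c * left a = left a * right c
  odd_comm : ∀ a c, θC.auto c = -c → right c * left a = left (θA.auto a) * right c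

namespace GradedPair

section Basic

variable {A C : Type*} [CStarAlgebra A] [CStarAlgebra C] {θA : Grading A} {θC : Grading C}
  {F : Type*} [Ring F] [StarRing F] [Algebra ℂ F]

/-- The graded pair with the roles of the two factors exchanged. -/
def swap (g : GradedPair θA θC F) : GradedPair θC θA F where
  left := g.right
  right := g.left
  even_comm c a ha := by
    rw [← θC.proj_add_proj c, map_add, mul_add, add_mul, g.even_comm _ _ (θC.auto_proj_one c),
      g.odd_comm _ _ (θC.auto_proj_neg_one c), ha]
  odd_comm c a ha := by
    rw [← θC.proj_sub_proj c]
    conv_lhs => rw [← θC.proj_add_proj c]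
    rw [map_add, map_sub, mul_add, sub_mul, g.even_comm _ _ (θC.auto_proj_one c),
      g.odd_comm _ _ (θC.auto_proj_neg_one c), ha, map_neg, neg_mul, sub_neg_eq_add]

/-- The image of a graded pair under a `*`-homomorphism. -/
def map {E : Type*} [Ring E] [StarRing E] [Algebra ℂ E] (g : GradedPair θA θC F)
    (f : F →⋆ₐ[ℂ] E) : GradedPair θA θC E where
  left := f.comp g.left
  right := f.comp g.right
  even_comm a c hc := by
    simp only [StarAlgHom.comp_apply, ← map_mul, g.even_comm a c hc]
  odd_comm a c hc := by
    simp only [StarAlgHom.comp_apply, ← map_mul, g.odd_comm a c hc]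

/-- The linear map `a ⊗ c ↦ left a * right c`. -/
def mulMap (g : GradedPair θA θC F) : A ⊗[ℂ] C →ₗ[ℂ] F :=
  LinearMap.mul' ℂ F ∘ₗ
    TensorProduct.map g.left.toAlgHom.toLinearMap g.right.toAlgHom.toLinearMap

theorem mulMap_tmul (g : GradedPair θA θC F) (a : A) (c : C) :
    g.mulMap (a ⊗ₜ c) = g.left a * g.right c := rfl

theorem mulMap_map {E : Type*} [Ring E] [StarRing E] [Algebra ℂ E] (g : GradedPair θA θC F)
    (f : F →⋆ₐ[ℂ] E) (t : A ⊗[ℂ] C) : (g.map f).mulMap t = f (g.mulMap t) := by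
  induction t using TensorProduct.induction_on with
  | zero => simp only [map_zero]
  | add t u ht hu => simp only [map_add, ht, hu]
  | tmul a c => rw [mulMap_tmul, mulMap_tmul, map_mul]; rfl

theorem mulMap_swap_surjective {g : GradedPair θA θC F} (hg : Function.Surjective g.mulMap) :
    Function.Surjective g.swap.mulMap := by
  suffices hrange : g.mulMap.range ≤ g.swap.mulMap.range from
    LinearMap.range_eq_top.1 (top_unique ((LinearMap.range_eq_top.2 hg).ge.trans hrange))
  rintro _ ⟨t, rfl⟩
  induction t using TensorProduct.induction_on with
  | zero => simp only [map_zero, zero_mem]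
  | add t u ht hu => simpa only [map_add] using add_mem ht hu
  | tmul a c =>
    refine ⟨θC.proj 1 c ⊗ₜ a + θC.proj (-1) c ⊗ₜ θA.auto a, ?_⟩
    rw [map_add, mulMap_tmul, mulMap_tmul, mulMap_tmul]
    change g.right _ * g.left a + g.right _ * g.left (θA.auto a) = _
    rw [g.even_comm _ _ (θC.auto_proj_one c), g.odd_comm _ _ (θC.auto_proj_neg_one c),
      θA.involutive, ← mul_add, ← map_add, θC.proj_add_proj]

/-- The `*`-endomorphism `Θ` of `F` induces the gradings of the two factors. -/
def IsCovariant (g : GradedPair θA θC F) (Θ : F →⋆ₐ[ℂ] F) : Prop :=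
  (∀ a, Θ (g.left a) = g.left (θA.auto a)) ∧ ∀ c, Θ (g.right c) = g.right (θC.auto c)

theorem IsCovariant.swap {g : GradedPair θA θC F} {Θ : F →⋆ₐ[ℂ] F} (h : g.IsCovariant Θ) :
    g.swap.IsCovariant Θ := And.symm h

theorem IsCovariant.apply_mul {g : GradedPair θA θC F} {Θ : F →⋆ₐ[ℂ] F} (h : g.IsCovariant Θ)
    (a : A) (c : C) : Θ (g.left a * g.right c) = g.left (θA.auto a) * g.right (θC.auto c) := by
  rw [map_mul, h.1, h.2]

/-- `ψ` is the product functional `left a * right c ↦ ωA a * ωC c`. -/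
def IsProduct (g : GradedPair θA θC F) (ψ : PositiveFunctional F) (ωA : EvenState θA)
    (ωC : EvenState θC) : Prop :=
  ∀ a c, ψ (g.left a * g.right c) = ωA a * ωC c

namespace IsProduct

variable {g : GradedPair θA θC F} {ψ ψ' : PositiveFunctional F} {ωA : EvenState θA}
  {ωC : EvenState θC}

theorem apply_one (h : g.IsProduct ψ ωA ωC) : ψ 1 = 1 := by
  simpa only [map_one, mul_one, ωA.apply_one, ωC.apply_one] using h 1 1

theorem apply_mulMap (h : g.IsProduct ψ ωA ωC) (t : A ⊗[ℂ] C) :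
    ψ (g.mulMap t) = LinearMap.mul' ℂ ℂ (TensorProduct.map ωA.toLinearMap ωC.toLinearMap t) := by
  induction t using TensorProduct.induction_on with
  | zero => simp only [map_zero]
  | add t u ht hu => simp only [map_add, ht, hu]
  | tmul a c => exact h a c

theorem eq (hg : Function.Surjective g.mulMap) (h : g.IsProduct ψ ωA ωC)
    (h' : g.IsProduct ψ' ωA ωC) : ψ = ψ' := by
  ext x
  obtain ⟨t, rfl⟩ := hg x
  rw [h.apply_mulMap, h'.apply_mulMap]

theorem swap (h : g.IsProduct ψ ωA ωC) : g.swap.IsProduct ψ ωC ωA := fun c a => by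
  change ψ (g.right c * g.left a) = ωC c * ωA a
  have heven : ωA (θA.auto a) = ωA a := ωA.even' a
  rw [← θC.proj_add_proj c, map_add, add_mul, g.even_comm _ _ (θC.auto_proj_one c),
    g.odd_comm _ _ (θC.auto_proj_neg_one c), map_add, h, h, heven, map_add, mul_comm (ωC _ + ωC _),
    mul_add]

end IsProduct

end Basic

section ProductState

variable {A C : Type*} [CStarAlgebra A] [CommCStarAlgebra C] {θA : Grading A} {θC : Grading C}
  {F : Type*} [Ring F] [StarRing F] [Algebra ℂ F]

theorem star_right_mul_mul_right (g : GradedPair θA θC F) {b : C} (hb : θC.auto b = -b) (a : A)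
    (d : C) : star (g.right b) * (g.left a * g.right d * g.right b) =
      g.left (θA.auto a) * g.right d * g.right (star b * b) := by
  have hb' : θC.auto (star b) = -star b := by rw [map_star, hb, star_neg]
  rw [← map_star, mul_assoc (g.left a), ← mul_assoc, g.odd_comm _ _ hb', mul_assoc, mul_assoc,
    ← map_mul, ← map_mul, ← map_mul, mul_left_comm]

variable [StarModule ℂ F] {g : GradedPair θA θC F} {φ : PositiveFunctional F}

/-- The twist is conjugation by an odd element `b` with `φ (b* b) ≠ 0`; if there is none, then `φ`
vanishes on the products with an odd right factor and needs no twist. -/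
theorem exists_twist (hφ : φ 1 = 1)
    (hmul : ∀ c, θC.auto c = c → φ (g.right (star c * c)) = star (φ (g.right c)) * φ (g.right c)) :
    ∃ κ : PositiveFunctional F, ∀ a d, θA.auto a = a ∨ θC.auto d = -d →
      κ (g.left a * g.right d) = φ (g.left (θA.auto a) * g.right d) := by
  by_cases hodd : ∀ b, θC.auto b = -b → φ (g.right (star b * b)) = 0
  · refine ⟨φ, fun a d had => ?_⟩
    obtain ha | hd := had
    · rw [ha]
    · have hzero : φ (star (g.right d) * g.right d) = 0 := by
        rw [← map_star, ← map_mul, hodd d hd]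
      rw [φ.apply_mul_eq_zero hzero, φ.apply_mul_eq_zero hzero]
  · push Not at hodd
    obtain ⟨b, hb, hr⟩ := hodd
    have hbb : θC.auto (star b * b) = star b * b := by
      rw [map_mul, map_star, hb, star_neg, neg_mul_neg]
    obtain ⟨r, hr'⟩ : ∃ r : ℝ≥0, (r : ℂ) = φ (g.right (star b * b)) := by
      have hnonneg := φ.nonneg (g.right b)
      rw [← map_star, ← map_mul] at hnonneg
      exact ⟨⟨_, (Complex.nonneg_iff.1 hnonneg).1⟩,
        Complex.ext rfl (Complex.nonneg_iff.1 hnonneg).2⟩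
    refine ⟨r⁻¹ • φ.conj (g.right b), fun a d _ => ?_⟩
    have hmult := φ.apply_mul_of_apply_star_mul_self hφ (c := g.right (star b * b)) (by
      rw [← map_star, ← map_mul, hmul _ hbb])
    rw [PositiveFunctional.smul_apply, PositiveFunctional.conj_apply,
      g.star_right_mul_mul_right hb, hmult, ← hr', NNReal.coe_inv, Complex.ofReal_inv,
      mul_comm, mul_inv_cancel_right₀ (by rwa [hr'])]

theorem IsCovariant.average_apply {Θ : F →⋆ₐ[ℂ] F} (hΘ : g.IsCovariant Θ) (hφ : φ 1 = 1)
    (hmul : ∀ c, θC.auto c = c → φ (g.right (star c * c)) = star (φ (g.right c)) * φ (g.right c))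
    {κ : PositiveFunctional F} (hκ : ∀ a d, θA.auto a = a ∨ θC.auto d = -d →
      κ (g.left a * g.right d) = φ (g.left (θA.auto a) * g.right d)) (a : A) (c : C) :
    ((4⁻¹ : ℝ≥0) • (φ + φ.comp Θ + (κ + κ.comp Θ))) (g.left a * g.right c) =
      φ (g.left (θA.proj 1 a)) * φ (g.right (θC.proj 1 c)) := by
  have ha := θA.auto_proj_one a
  have ha' := θA.auto_proj_neg_one a
  have hc := θC.auto_proj_one c
  have hc' := θC.auto_proj_neg_one c
  set P := (4⁻¹ : ℝ≥0) • (φ + φ.comp Θ + (κ + κ.comp Θ))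
  have hP (a c) : P (g.left a * g.right c) = 4⁻¹ * (φ (g.left a * g.right c) +
      φ (g.left (θA.auto a) * g.right (θC.auto c)) + (κ (g.left a * g.right c) +
        κ (g.left (θA.auto a) * g.right (θC.auto c)))) := by
    simp only [← hΘ.apply_mul, P, PositiveFunctional.smul_apply, PositiveFunctional.add_apply,
      PositiveFunctional.comp_apply, NNReal.coe_inv, NNReal.coe_ofNat, Complex.ofReal_inv,
      Complex.ofReal_ofNat]
  have heven_even : P (g.left (θA.proj 1 a) * g.right (θC.proj 1 c)) =
      φ (g.left (θA.proj 1 a)) * φ (g.right (θC.proj 1 c)) := by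
    rw [hP, ha, hc, hκ _ _ (.inl ha), ha, φ.apply_mul_of_apply_star_mul_self hφ (by
      rw [← map_star, ← map_mul, hmul _ hc])]
    ring
  have heven_odd : P (g.left (θA.proj 1 a) * g.right (θC.proj (-1) c)) = 0 := by
    rw [hP, ha, hc']
    simp only [map_neg, mul_neg]
    ring
  have hodd_even : P (g.left (θA.proj (-1) a) * g.right (θC.proj 1 c)) = 0 := by
    rw [hP, ha', hc]
    simp only [map_neg, neg_mul]
    ring
  have hodd_odd : P (g.left (θA.proj (-1) a) * g.right (θC.proj (-1) c)) = 0 := by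
    rw [hP, ha', hc', map_neg, map_neg, neg_mul_neg, hκ _ _ (.inr hc'), ha', map_neg, neg_mul,
      map_neg]
    ring
  conv_lhs => rw [← θA.proj_add_proj a, ← θC.proj_add_proj c]
  simp only [map_add, add_mul, mul_add, heven_even, heven_odd, hodd_even, hodd_odd, add_zero]

theorem exists_isProduct {Θ : F →⋆ₐ[ℂ] F} (hΘ : g.IsCovariant Θ) (hφ : φ 1 = 1)
    (hmul : ∀ c, θC.auto c = c → φ (g.right (star c * c)) = star (φ (g.right c)) * φ (g.right c)) :
    ∃ P : PositiveFunctional F,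
      g.IsProduct P (.ofState φ hφ θA g.left) (.ofState φ hφ θC g.right) ∧
      ∀ z, ‖φ.toPre z‖ ≤ 2 * ‖P.toPre z‖ := by
  obtain ⟨κ, hκ⟩ := exists_twist hφ hmul
  refine ⟨(4⁻¹ : ℝ≥0) • (φ + φ.comp Θ + (κ + κ.comp Θ)), fun a c => ?_, fun z => ?_⟩
  · rw [hΘ.average_apply hφ hmul hκ, EvenState.ofState_apply, EvenState.ofState_apply]
  · refine PositiveFunctional.norm_toPre_le_mul_norm_toPre zero_le_two ?_
    rw [PositiveFunctional.smul_apply, PositiveFunctional.add_apply, PositiveFunctional.add_apply,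
      PositiveFunctional.add_apply, add_assoc, NNReal.coe_inv, Complex.ofReal_inv, ← mul_assoc]
    norm_num
    exact add_nonneg ((φ.comp Θ).nonneg z) (add_nonneg (κ.nonneg z) ((κ.comp Θ).nonneg z))

end ProductState

section EvenCross

variable {A C B : Type*} [CStarAlgebra A] [CStarAlgebra C] [CStarAlgebra B] {θA : Grading A}
  {θC : Grading C} {g : GradedPair θA θC B}

/-- The norm is multiplicative on products of even elements of the two factors. -/
def IsEvenCross (g : GradedPair θA θC B) : Prop :=
  ∀ a c, θA.auto a = a → θC.auto c = c → ‖g.left a * g.right c‖ = ‖a‖ * ‖c‖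

theorem IsEvenCross.swap (hg : g.IsEvenCross) : g.swap.IsEvenCross := fun c a hc ha => by
  change ‖g.right c * g.left a‖ = ‖c‖ * ‖a‖
  rw [g.even_comm a c hc, hg a c ha hc, mul_comm]

theorem norm_left_mul_right_le (g : GradedPair θA θC B) (a : A) (c : C) :
    ‖g.left a * g.right c‖ ≤ ‖a‖ * ‖c‖ :=
  (norm_mul_le _ _).trans (mul_le_mul (NonUnitalStarAlgHom.norm_apply_le g.left a)
    (NonUnitalStarAlgHom.norm_apply_le g.right c) (norm_nonneg _) (norm_nonneg _))

theorem IsEvenCross.norm_sum_smul_le_add (hg : g.IsEvenCross) (τ : C →⋆ₐ[ℂ] ℂ) {ι : Type*}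
    {s : Finset ι} {a : ι → A} {c : ι → C} (ha : ∀ k ∈ s, θA.auto (a k) = a k) {e : C}
    (he : θC.auto e = e) (hne : ‖e‖ ≤ 1) (hτe : τ e = 1) {δ : ℝ}
    (hδ : ∀ k ∈ s, ‖(c k - τ (c k) • 1) * e‖ ≤ δ) :
    ‖∑ k ∈ s, τ (c k) • a k‖ ≤ ‖∑ k ∈ s, g.left (a k) * g.right (c k)‖ + (∑ k ∈ s, ‖a k‖) * δ := by
  have hne' : 1 ≤ ‖e‖ := by simpa only [hτe, norm_one] using NonUnitalStarAlgHom.norm_apply_le τ e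
  have heven : θA.auto (∑ k ∈ s, τ (c k) • a k) = ∑ k ∈ s, τ (c k) • a k := by
    rw [map_sum]
    exact Finset.sum_congr rfl fun k hk => by rw [θA.auto_smul, ha k hk]
  have hdecomp : g.left (∑ k ∈ s, τ (c k) • a k) * g.right e =
      (∑ k ∈ s, g.left (a k) * g.right (c k)) * g.right e -
        ∑ k ∈ s, g.left (a k) * g.right ((c k - τ (c k) • 1) * e) := by
    rw [map_sum, Finset.sum_mul, Finset.sum_mul, ← Finset.sum_sub_distrib]
    refine Finset.sum_congr rfl fun k _ => ?_
    rw [map_smul, map_mul, map_sub, map_smul, map_one, sub_mul, mul_sub, smul_mul_assoc,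
      smul_mul_assoc, one_mul, mul_smul_comm, mul_assoc, sub_sub_cancel]
  have hmain : ‖(∑ k ∈ s, g.left (a k) * g.right (c k)) * g.right e‖ ≤
      ‖∑ k ∈ s, g.left (a k) * g.right (c k)‖ :=
    (norm_mul_le _ _).trans (mul_le_of_le_one_right (norm_nonneg _)
      ((NonUnitalStarAlgHom.norm_apply_le g.right e).trans hne))
  have herror : ‖∑ k ∈ s, g.left (a k) * g.right ((c k - τ (c k) • 1) * e)‖ ≤
      (∑ k ∈ s, ‖a k‖) * δ := by
    rw [Finset.sum_mul]
    exact norm_sum_le_of_le s fun k hk => (g.norm_left_mul_right_le _ _).trans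
      (mul_le_mul_of_nonneg_left (hδ k hk) (norm_nonneg _))
  calc ‖∑ k ∈ s, τ (c k) • a k‖
      ≤ ‖∑ k ∈ s, τ (c k) • a k‖ * ‖e‖ := le_mul_of_one_le_right (norm_nonneg _) hne'
    _ = ‖g.left (∑ k ∈ s, τ (c k) • a k) * g.right e‖ := (hg _ e heven he).symm
    _ ≤ ‖∑ k ∈ s, g.left (a k) * g.right (c k)‖ + (∑ k ∈ s, ‖a k‖) * δ := by
      rw [hdecomp]
      exact (norm_sub_le _ _).trans (add_le_add hmain herror)

/-- Multiplying by an even bump `e` concentrated near `τ` replaces every `c k` by the scalar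
`τ (c k)` up to a small error, and then the norm factorizes. -/
theorem IsEvenCross.norm_sum_smul_le (hg : g.IsEvenCross) (τ : C →⋆ₐ[ℂ] ℂ) {ι : Type*}
    {s : Finset ι} {a : ι → A} {c : ι → C} (ha : ∀ k ∈ s, θA.auto (a k) = a k)
    (hc : ∀ k ∈ s, θC.auto (c k) = c k) :
    ‖∑ k ∈ s, τ (c k) • a k‖ ≤ ‖∑ k ∈ s, g.left (a k) * g.right (c k)‖ := by
  refine le_of_forall_pos_le_add fun ε hε => ?_
  obtain ⟨e, he, hne, hτe, hδ⟩ := exists_even_bump θC τ (u := fun k => c k - τ (c k) • 1)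
    (fun k hk => by rw [map_sub, θC.auto_smul, map_one, hc k hk])
    (fun k _ => by rw [map_sub, map_smul, map_one, smul_eq_mul, mul_one, sub_self])
    (δ := ε / (∑ k ∈ s, ‖a k‖ + 1)) (by positivity)
  have hε' : (∑ k ∈ s, ‖a k‖) * (ε / (∑ k ∈ s, ‖a k‖ + 1)) ≤ ε := by
    rw [mul_div_assoc', div_le_iff₀ (by positivity)]
    linarith [mul_comm ε (∑ k ∈ s, ‖a k‖)]
  exact (hg.norm_sum_smul_le_add τ ha he hne hτe hδ).trans (add_le_add_right hε' _)

theorem IsEvenCross.exists_state (hg : g.IsEvenCross) {ω : PositiveFunctional A} (hω : ω 1 = 1)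
    (τ : C →⋆ₐ[ℂ] ℂ) :
    ∃ φ : PositiveFunctional B, φ 1 = 1 ∧ ∀ a c, θA.auto a = a → θC.auto c = c →
      φ (g.left a * g.right c) = ω a * τ c := by
  let T : A ⊗[ℂ] C →ₗ[ℂ] B := g.mulMap ∘ₗ fermiComp θA θC 1 1
  let Q : A ⊗[ℂ] C →ₗ[ℂ] ℂ := LinearMap.mul' ℂ ℂ ∘ₗ
    TensorProduct.map ω.toLinearMap τ.toAlgHom.toLinearMap ∘ₗ fermiComp θA θC 1 1
  have hT (a : A) (c : C) : T (a ⊗ₜ c) = g.left (θA.proj 1 a) * g.right (θC.proj 1 c) := rfl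
  have hQ (a : A) (c : C) : Q (a ⊗ₜ c) = ω (θA.proj 1 a) * τ (θC.proj 1 c) := rfl
  have hTQ (t : A ⊗[ℂ] C) : ‖Q t‖ ≤ ‖T t‖ := by
    obtain ⟨s, rfl⟩ := TensorProduct.exists_finset t
    calc ‖Q (∑ p ∈ s, p.1 ⊗ₜ p.2)‖
        = ‖ω (∑ p ∈ s, τ (θC.proj 1 p.2) • θA.proj 1 p.1)‖ := by
          simp only [map_sum, map_smul, hQ, smul_eq_mul, mul_comm]
      _ ≤ ‖∑ p ∈ s, τ (θC.proj 1 p.2) • θA.proj 1 p.1‖ := PositiveFunctional.norm_apply_le hω _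
      _ ≤ ‖∑ p ∈ s, g.left (θA.proj 1 p.1) * g.right (θC.proj 1 p.2)‖ :=
          hg.norm_sum_smul_le τ (fun _ _ => θA.auto_proj_one _) fun _ _ => θC.auto_proj_one _
      _ = ‖T (∑ p ∈ s, p.1 ⊗ₜ p.2)‖ := by simp only [map_sum, hT]
  have hA := (θA.proj_of_even (map_one θA.auto)).1
  have hC := (θC.proj_of_even (map_one θC.auto)).1
  obtain ⟨φ, hφ, hext⟩ := PositiveFunctional.exists_extension T Q hTQ (v₀ := 1 ⊗ₜ 1)
    (by rw [hT, hA, hC, map_one, map_one, mul_one]) (by rw [hQ, hA, hC, hω, map_one, mul_one])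
  refine ⟨φ, hφ, fun a c ha hc => ?_⟩
  rw [← (θA.proj_of_even ha).1, ← (θC.proj_of_even hc).1]
  exact hext (a ⊗ₜ c)

end EvenCross

section UpperBound

variable {A C B : Type*} [CStarAlgebra A] [CommCStarAlgebra C] [CStarAlgebra B] {θA : Grading A}
  {θC : Grading C}

theorem IsEvenCross.exists_isProduct {g : GradedPair θA θC B} (hg : g.IsEvenCross)
    {Θ : B →⋆ₐ[ℂ] B} (hΘ : g.IsCovariant Θ) (ωA : EvenState θA) (τ : C →⋆ₐ[ℂ] ℂ) :
    ∃ (ωC : EvenState θC) (P : PositiveFunctional B), (∀ c, ωC c = τ (θC.proj 1 c)) ∧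
      g.IsProduct P ωA ωC := by
  obtain ⟨φ, hφ, hmul⟩ := hg.exists_state ωA.apply_one τ
  have hleft {a : A} (ha : θA.auto a = a) : φ (g.left a) = ωA a := by
    simpa only [map_one, mul_one] using hmul a 1 ha (map_one θC.auto)
  have hright {c : C} (hc : θC.auto c = c) : φ (g.right c) = τ c := by
    simpa only [map_one, one_mul, ωA.apply_one] using hmul 1 c (map_one θA.auto) hc
  obtain ⟨P, hP, -⟩ := GradedPair.exists_isProduct hΘ hφ fun c hc => by
    rw [hright hc, hright (by rw [map_mul, map_star, hc]), map_mul, map_star]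
  refine ⟨.ofState φ hφ θC g.right, P, fun c => ?_, fun a c => ?_⟩
  · rw [EvenState.ofState_apply, hright (θC.auto_proj_one c)]
  · rw [hP a c, EvenState.ofState_apply, hleft (θA.auto_proj_one a), ωA.apply_proj_one]

theorem IsEvenCross.norm_mul'_map_le {g : GradedPair θA θC B} (hg : g.IsEvenCross)
    {Θ : B →⋆ₐ[ℂ] B} (hΘ : g.IsCovariant Θ) (ωA : EvenState θA) (ωC : EvenState θC)
    (t : A ⊗[ℂ] C) :
    ‖LinearMap.mul' ℂ ℂ (TensorProduct.map ωA.toLinearMap ωC.toLinearMap t)‖ ≤ ‖g.mulMap t‖ := by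
  have : Nontrivial C :=
    ⟨1, 0, fun h => by simpa only [h, map_zero, zero_ne_one] using ωC.apply_one⟩
  let y : C := TensorProduct.lid ℂ C (TensorProduct.map ωA.toLinearMap LinearMap.id t)
  have hslice (ω : EvenState θC) :
      LinearMap.mul' ℂ ℂ (TensorProduct.map ωA.toLinearMap ω.toLinearMap t) = ω y := by
    simp only [y]
    induction t using TensorProduct.induction_on with
    | zero => simp only [map_zero]
    | add t u ht hu => simp only [map_add, ht, hu]
    | tmul a c => exact (ω.toLinearMap.map_smul (ωA a) c).symm
  obtain ⟨τ, hτ⟩ := exists_character_norm_eq (θC.proj 1 y)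
  obtain ⟨ω, P, hω, hP⟩ := hg.exists_isProduct hΘ ωA τ
  calc ‖LinearMap.mul' ℂ ℂ (TensorProduct.map ωA.toLinearMap ωC.toLinearMap t)‖
      = ‖ωC (θC.proj 1 y)‖ := by rw [hslice, ωC.apply_proj_one]
    _ ≤ ‖θC.proj 1 y‖ := PositiveFunctional.norm_apply_le ωC.apply_one _
    _ = ‖P (g.mulMap t)‖ := by rw [← hτ, ← hω, ← hslice, hP.apply_mulMap]
    _ ≤ ‖g.mulMap t‖ := PositiveFunctional.norm_apply_le hP.apply_one _

theorem IsProduct.norm_gnsRep_le {F : Type*} [Ring F] [StarRing F] [Algebra ℂ F] [StarModule ℂ F]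
    {g : GradedPair θA θC F} (hg : Function.Surjective g.mulMap) {f : F →⋆ₐ[ℂ] B}
    (hf : (g.map f).IsEvenCross) {Θ : B →⋆ₐ[ℂ] B} (hΘ : (g.map f).IsCovariant Θ)
    {ψ : PositiveFunctional F} {ωA : EvenState θA} {ωC : EvenState θC}
    (hψ : g.IsProduct ψ ωA ωC) (hb : ∀ x, ψ.LeftBounded x) (x : F) :
    ‖ψ.gnsRep hb x‖ ≤ ‖f x‖ := by
  have hbound (z : F) : ‖ψ z‖ ≤ ‖f z‖ := by
    obtain ⟨t, rfl⟩ := hg z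
    rw [hψ.apply_mulMap, ← mulMap_map]
    exact hf.norm_mul'_map_le hΘ ωA ωC t
  obtain ⟨φ, -, hφ⟩ := PositiveFunctional.exists_extension f.toAlgHom.toLinearMap ψ.toLinearMap
    hbound (map_one f) hψ.apply_one
  obtain rfl : φ.comp f = ψ := PositiveFunctional.ext hφ
  exact PositiveFunctional.norm_gnsRep_comp_le hb x

end UpperBound

section LowerBound

variable {A C : Type*} [CStarAlgebra A] [CommCStarAlgebra C] {θA : Grading A} {θC : Grading C}

theorem commute_right_mulMap {F : Type*} [Ring F] [StarRing F] [Algebra ℂ F]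
    (g : GradedPair θA θC F) {c : C} (hc : θC.auto c = c) (t : A ⊗[ℂ] C) :
    Commute (g.right c) (g.mulMap t) := by
  induction t using TensorProduct.induction_on with
  | zero => simp only [map_zero, Commute.zero_right]
  | add t u ht hu => simpa only [map_add] using ht.add_right hu
  | tmul a d =>
    exact (show Commute (g.right c) (g.left a) from g.even_comm a c hc).mul_right
      ((Commute.all c d).map g.right)

variable {B : Type*} [CStarAlgebra B] [Nontrivial B]

theorem exists_multiplicative_state (g : GradedPair θA θC B) {h : B} (hh : IsSelfAdjoint h)
    (hcomm : ∀ c, θC.auto c = c → Commute (g.right c) h) :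
    ∃ φ : PositiveFunctional B, φ 1 = 1 ∧
      (∀ c, θC.auto c = c → φ (g.right (star c * c)) = star (φ (g.right c)) * φ (g.right c)) ∧
      ‖φ h‖ = ‖h‖ := by
  let S : Set B := insert h (Set.image g.right {c | θC.auto c = c})
  have hstar_mem : ∀ x ∈ S, star x ∈ S := by
    rintro x (rfl | ⟨c, hc, rfl⟩)
    · exact .inl hh.star_eq
    · exact .inr ⟨star c, (map_star θC.auto c).trans (congrArg star hc), map_star g.right c⟩
  have hstar : star S = S :=
    Set.Subset.antisymm (fun x hx => star_star x ▸ hstar_mem _ hx) hstar_mem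
  have hS : ∀ x ∈ S, ∀ y ∈ S, x * y = y * x := by
    rintro x (rfl | ⟨c, hc, rfl⟩) y (rfl | ⟨d, hd, rfl⟩)
    · rfl
    · exact (hcomm d hd).symm
    · exact hcomm c hc
    · exact (Commute.all c d).map g.right
  obtain ⟨φ, hφ, hmul, hnorm⟩ :=
    PositiveFunctional.exists_multiplicativeOn hstar hS (Set.mem_insert h _)
  refine ⟨φ, hφ, fun c hc => ?_, hnorm⟩
  rw [map_mul, map_star]
  exact hmul _ (.inr ⟨c, hc, rfl⟩)

theorem exists_isProduct_le_norm_gnsRep {F : Type*} [Ring F] [StarRing F] [Algebra ℂ F]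
    [StarModule ℂ F] {g : GradedPair θA θC F} (hg : Function.Surjective g.mulMap)
    {f : F →⋆ₐ[ℂ] B} {Θ : B →⋆ₐ[ℂ] B} (hΘ : (g.map f).IsCovariant Θ)
    (hb : ∀ (ψ : PositiveFunctional F) x, ψ.LeftBounded x) (x : F) :
    ∃ (ωA : EvenState θA) (ωC : EvenState θC) (ψ : PositiveFunctional F),
      g.IsProduct ψ ωA ωC ∧ ‖f x‖ ≤ ‖ψ.gnsRep (hb ψ) x‖ := by
  have hcomm (c : C) (hc : θC.auto c = c) :
      Commute ((g.map f).right c) (star (f x) * f x) := by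
    obtain ⟨t, ht⟩ := hg (star x * x)
    rw [← map_star, ← map_mul, ← ht, ← mulMap_map]
    exact (g.map f).commute_right_mulMap hc t
  obtain ⟨φ, hφ, hmul, hnorm⟩ :=
    (g.map f).exists_multiplicative_state (IsSelfAdjoint.star_mul_self (f x)) hcomm
  obtain ⟨P, hP, hle⟩ := GradedPair.exists_isProduct hΘ hφ hmul
  have hψ : g.IsProduct (P.comp f) _ _ := fun a c =>
    (congrArg P (map_mul f (g.left a) (g.right c))).trans (hP a c)
  refine ⟨_, _, P.comp f, hψ, ?_⟩
  have hdom (z : F) : ‖(φ.comp f).toPre z‖ ≤ 2 * ‖(P.comp f).toPre z‖ := by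
    simpa only [PositiveFunctional.norm_toPre_comp] using hle (f z)
  rw [← sq_le_sq₀ (norm_nonneg _) (norm_nonneg _)]
  calc ‖f x‖ ^ 2 = ‖(φ.comp f) (star x * x)‖ := by
        rw [PositiveFunctional.comp_apply, map_mul, map_star, hnorm, CStarRing.norm_star_mul_self,
          sq]
    _ ≤ ‖(φ.comp f).gnsRep (hb _) (star x * x)‖ :=
        PositiveFunctional.norm_apply_le_norm_gnsRep _ ((congrArg φ (map_one f)).trans hφ) _
    _ ≤ ‖(P.comp f).gnsRep (hb _) (star x * x)‖ :=
        PositiveFunctional.norm_gnsRep_le_of_norm_toPre_le _ _ hdom _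
    _ = ‖(P.comp f).gnsRep (hb _) x‖ ^ 2 := by
        rw [map_mul, map_star, ContinuousLinearMap.star_eq_adjoint, ContinuousLinearMap.mul_def,
          ContinuousLinearMap.norm_adjoint_comp_self, sq]

end LowerBound

end GradedPair

namespace CStarNorm

variable {F : Type*} [Ring F] [StarRing F] [Algebra ℂ F] [StarModule ℂ F]

/-- The canonical map of `F` into its completion as a `*`-homomorphism. -/
def completionHom (β : CStarNorm F) : F →⋆ₐ[ℂ] β.Completion where
  toFun := β.toCompletion
  map_one' := Completion.coe_one β.Carrier
  map_mul' x y := Completion.coe_mul (β.toCarrier x) (β.toCarrier y)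
  map_zero' := Completion.coe_zero
  map_add' x y := Completion.coe_add (β.toCarrier x) (β.toCarrier y)
  commutes' r := by
    rw [Algebra.algebraMap_eq_smul_one, Algebra.algebraMap_eq_smul_one]
    exact (Completion.coe_smul r (β.toCarrier 1)).trans
      (congrArg (r • ·) (Completion.coe_one β.Carrier))
  map_star' x := β.coe_star (β.toCarrier x)

theorem norm_completionHom (β : CStarNorm F) (x : F) : ‖β.completionHom x‖ = β x :=
  Completion.norm_coe (β.toCarrier x)

end CStarNorm

namespace FermiTensor

variable {A₁ A₂ : Type*} [CStarAlgebra A₁] [CStarAlgebra A₂] {θ₁ : Grading A₁} {θ₂ : Grading A₂}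

theorem inr_mul_inl (a : A₁) (b : A₂) : inr θ₁ θ₂ b * inl θ₁ θ₂ a =
    tmul θ₁ θ₂ a (θ₂.proj 1 b) + tmul θ₁ θ₂ (θ₁.auto a) (θ₂.proj (-1) b) := by
  change tmul θ₁ θ₂ 1 b * tmul θ₁ θ₂ a 1 = _
  rw [tmul_mul_tmul, one_mul, mul_one, one_mul, mul_one]

/-- The two embeddings `inl` and `inr` into the Fermi tensor product. -/
def pair (θ₁ : Grading A₁) (θ₂ : Grading A₂) : GradedPair θ₁ θ₂ (FermiTensor θ₁ θ₂) where
  left := inl θ₁ θ₂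
  right := inr θ₁ θ₂
  even_comm a b hb := by
    rw [inr_mul_inl, inl_mul_inr, (θ₂.proj_of_even hb).1, (θ₂.proj_of_even hb).2, tmul_zero,
      add_zero]
  odd_comm a b hb := by
    rw [inr_mul_inl, inl_mul_inr, (θ₂.proj_of_odd hb).1, (θ₂.proj_of_odd hb).2, tmul_zero,
      zero_add]

theorem mulMap_pair_surjective : Function.Surjective (pair θ₁ θ₂).mulMap := fun x => by
  induction x using FermiTensor.induction_on with
  | zero => exact ⟨0, map_zero _⟩
  | tmul a b => exact ⟨a ⊗ₜ b, inl_mul_inr a b⟩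
  | add x y hx hy =>
    obtain ⟨t, rfl⟩ := hx
    obtain ⟨u, rfl⟩ := hy
    exact ⟨t + u, map_add _ t u⟩

theorem isProduct_productState (ω₁ : EvenState θ₁) (ω₂ : EvenState θ₂) :
    (pair θ₁ θ₂).IsProduct (productState ω₁ ω₂) ω₁ ω₂ := fun a b =>
  (congrArg (productState ω₁ ω₂) (inl_mul_inr a b)).trans (productFunctional_tmul ω₁ ω₂ a b)

variable {β : CStarNorm (FermiTensor θ₁ θ₂)}

theorem IsCompatible.exists_isCovariant (hβ : IsCompatible β) :
    ∃ Θ : β.Completion →⋆ₐ[ℂ] β.Completion, ((pair θ₁ θ₂).map β.completionHom).IsCovariant Θ := by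
  obtain ⟨Θ, hΘ⟩ := hβ
  have hinl (a : A₁) : grading θ₁ θ₂ (inl θ₁ θ₂ a) = inl θ₁ θ₂ (θ₁.auto a) :=
    congrArg (tmul θ₁ θ₂ (θ₁.auto a)) (map_one θ₂.auto)
  have hinr (b : A₂) : grading θ₁ θ₂ (inr θ₁ θ₂ b) = inr θ₁ θ₂ (θ₂.auto b) :=
    congrArg (tmul θ₁ θ₂ · (θ₂.auto b)) (map_one θ₁.auto)
  exact ⟨Θ, fun a => (hΘ _).trans (congrArg β.toCompletion (hinl a)),
    fun b => (hΘ _).trans (congrArg β.toCompletion (hinr b))⟩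

theorem IsCross.isEvenCross (hβ : IsCross β) :
    ((pair θ₁ θ₂).map β.completionHom).IsEvenCross := fun a b ha hb => by
  change ‖β.completionHom (inl θ₁ θ₂ a) * β.completionHom (inr θ₁ θ₂ b)‖ = _
  rw [← map_mul, CStarNorm.norm_completionHom, inl_mul_inr, hβ a b (.inl ha) (.inl hb)]

theorem norm_gnsRep_productState_le
    (hcomm : (∀ a b : A₁, a * b = b * a) ∨ ∀ a b : A₂, a * b = b * a) (hcross : IsCross β)
    (hcompat : IsCompatible β) (ω₁ : EvenState θ₁) (ω₂ : EvenState θ₂) (x : FermiTensor θ₁ θ₂) :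
    ‖(productState ω₁ ω₂).gnsRep (leftBounded _) x‖ ≤ β x := by
  obtain ⟨Θ, hΘ⟩ := hcompat.exists_isCovariant
  rw [← CStarNorm.norm_completionHom]
  obtain hA₁ | hA₂ := hcomm
  · let _ : CommCStarAlgebra A₁ := { ‹CStarAlgebra A₁› with mul_comm := hA₁ }
    exact (isProduct_productState ω₁ ω₂).swap.norm_gnsRep_le
      (GradedPair.mulMap_swap_surjective mulMap_pair_surjective) hcross.isEvenCross.swap hΘ.swap _ x
  · let _ : CommCStarAlgebra A₂ := { ‹CStarAlgebra A₂› with mul_comm := hA₂ }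
    exact (isProduct_productState ω₁ ω₂).norm_gnsRep_le mulMap_pair_surjective hcross.isEvenCross
      hΘ _ x

theorem exists_le_norm_gnsRep_productState [Nontrivial β.Completion]
    (hcomm : (∀ a b : A₁, a * b = b * a) ∨ ∀ a b : A₂, a * b = b * a)
    (hcompat : IsCompatible β) (x : FermiTensor θ₁ θ₂) :
    ∃ (ω₁ : EvenState θ₁) (ω₂ : EvenState θ₂),
      β x ≤ ‖(productState ω₁ ω₂).gnsRep (leftBounded _) x‖ := by
  obtain ⟨Θ, hΘ⟩ := hcompat.exists_isCovariant
  rw [← CStarNorm.norm_completionHom]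
  obtain hA₁ | hA₂ := hcomm
  · let _ : CommCStarAlgebra A₁ := { ‹CStarAlgebra A₁› with mul_comm := hA₁ }
    have hsurj := GradedPair.mulMap_swap_surjective (mulMap_pair_surjective (θ₁ := θ₁) (θ₂ := θ₂))
    obtain ⟨ω₂, ω₁, ψ, hψ, hle⟩ :=
      GradedPair.exists_isProduct_le_norm_gnsRep hsurj hΘ.swap leftBounded x
    obtain rfl := hψ.eq hsurj (isProduct_productState ω₁ ω₂).swap
    exact ⟨ω₁, ω₂, hle⟩
  · let _ : CommCStarAlgebra A₂ := { ‹CStarAlgebra A₂› with mul_comm := hA₂ }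
    obtain ⟨ω₁, ω₂, ψ, hψ, hle⟩ :=
      GradedPair.exists_isProduct_le_norm_gnsRep mulMap_pair_surjective hΘ leftBounded x
    obtain rfl := hψ.eq mulMap_pair_surjective (isProduct_productState ω₁ ω₂)
    exact ⟨ω₁, ω₂, hle⟩

end FermiTensor

end

theorem mainTheorem2 {A₁ A₂ : Type*} [CStarAlgebra A₁] [CStarAlgebra A₂]
    (θ₁ : Grading A₁) (θ₂ : Grading A₂)
    (hcomm : (∀ a b : A₁, a * b = b * a) ∨ (∀ a b : A₂, a * b = b * a))
    (β : CStarNorm (FermiTensor θ₁ θ₂))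
    (hcross : FermiTensor.IsCross β) (hcompat : FermiTensor.IsCompatible β)
    (x : FermiTensor θ₁ θ₂) :
    β x = FermiTensor.spatialNorm x := by
  have hle (ω : EvenState θ₁ × EvenState θ₂) :
      ‖(FermiTensor.productState ω.1 ω.2).gnsRep (FermiTensor.leftBounded _) x‖ ≤ β x :=
    FermiTensor.norm_gnsRep_productState_le hcomm hcross hcompat ω.1 ω.2 x
  refine le_antisymm ?_ (Real.iSup_le hle (apply_nonneg _ _))
  obtain hsub | hnontriv := subsingleton_or_nontrivial β.Completion
  · rw [← CStarNorm.norm_completionHom, Subsingleton.elim (β.completionHom x) 0, norm_zero]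
    exact Real.iSup_nonneg fun _ => norm_nonneg _
  · obtain ⟨ω₁, ω₂, hge⟩ := FermiTensor.exists_le_norm_gnsRep_productState hcomm hcompat x
    exact hge.trans (le_ciSup ⟨β x, Set.forall_mem_range.2 hle⟩ (ω₁, ω₂))
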